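/- Let $n\ge 1$, $q\in(0,1)$ and $a=(a_1,\dots,a_n)\in\mathbb{R}_{>0}^n$. Let $\mathcal{W}_0^n=\{z\in\mathbb{Z}^n: z_1\ge\dots\ge z_n\ge 0\}$. For rows of integers write $x\preceq y$ if $y_1\ge x_1\ge y_2\ge x_2\ge\cdots$; a row $x=(x_1,\dots,x_m)$ is extended by $x_0=+\infty$ and $x_j=0$ for $j>m$, and $|x|=x_1+\dots+x_m$. Let $\mathbb{K}_0^{2n}$ be the set of integer symplectic Gelfand–Tsetlin patterns $\mathbf{z}=(z^1,\dots,z^{2n})$, i.e. $z^{2l-1},z^{2l}\in\mathbb{Z}_{\ge0}^l$ for $1\le l\le n$ and $z^{k-1}\preceq z^{k}$ for $2\le k\le 2n$. The shape of $\mathbf{z}$ is $z^{2n}\in\mathcal{W}_0^n$. Put $$r_i(y;x)=q^{y_i-x_i}\,\frac{1-q^{x_{i-1}-y_i}}{1-q^{x_{i-1}-x_i}},\qquad l_i(y;x)=q^{x_i-y_{i+1}}\,\frac{1-q^{y_{i+1}-x_{i+1}}}{1-q^{x_i-x_{i+1}}},$$ so that $r_1(y;x)=q^{y_1-x_1}$.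 **Dynamics.** The $q$-deformed Berele dynamics is the continuous-time Markov chain on $\mathbb{K}_0^{2n}$ in which, for $1\le l\le n$, the particle $Z_1^{2l-1}$ attempts a right jump at rate $a_l$ and the particle $Z_1^{2l}$ attempts a right jump at rate $a_l^{-1}$, independently. Each attempt propagates instantaneously down to level $2n$ by the following rules, in which $r_i,l_i$ are evaluated at the pattern just before the jump time and the random choices are independent. * If $Z^k_i$, $k<2n$, attempts a right jump and $k$ is odd with $i=\frac{k+1}{2}$, then with probability $r_i(Z^{k+1};Z^k)$ the jump is performed and $Z^{k+1}_i$ attempts a right jump; otherwise the jump is suppressed and $Z_i^{k+1}$ jumps to the left. * If any other particle $Z^k_i$, $k<2n$, attempts a right jump, the jump is performed, and then $Z^{k+1}_i$ attempts a right jump with probability $r_i(Z^{k+1};Z^k)$, and otherwise $Z^{k+1}_{i+1}$ does. * If $Z^k_i$, $k<2n$, jumps to the left, then $Z^{k+1}_{i+1}$ jumps to the left with probability $l_i(Z^{k+1};Z^k)$, and otherwise $Z^{k+1}_i$ does. * Jumps attempted at level $2n$ are performed and end the move. **Weights.** With $\binom{m}{k}_q=\frac{m!_q}{k!_q\,(m-k)!_q}$,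 $m!_q=\prod_{k=1}^m\frac{1-q^k}{1-q}$ and $|z^0|=0$, let $$w_{a,q}(\mathbf{z})=\prod_{k=1}^n\Big[a_k^{2|z^{2k-1}|-|z^{2k-2}|-|z^{2k}|}\binom{z^{2k}_k}{z^{2k}_k-z^{2k-1}_k}_q\prod_{i=1}^{k-1}\binom{z^{2k-1}_i-z^{2k-1}_{i+1}}{z^{2k-1}_i-z^{2k-2}_i}_q\binom{z^{2k}_i-z^{2k}_{i+1}}{z^{2k}_i-z^{2k-1}_i}_q\Big].$$ For $z\in\mathcal{W}_0^n$ let $\mathcal{P}^{(n)}_z(a;q)=\sum_{\mathbf{z}\in\mathbb{K}_0^{2n}:\,z^{2n}=z}w_{a,q}(\mathbf{z})$, and let $M^n_{a,q}(\cdot;z)$ be the probability law on $\mathbb{K}_0^{2n}$ with mass $w_{a,q}(\mathbf{z})/\mathcal{P}^{(n)}_z(a;q)$ at each $\mathbf{z}$ with $z^{2n}=z$ and zero mass elsewhere. **Theorem.** Let $(\mathbf{Z}(t),t\ge0)$ be a Markov process on $\mathbb{K}_0^{2n}$ that evolves according to the $q$-deformed Berele dynamics, with initial distribution $M^n_{a,q}(\cdot;z)$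 for some $z\in\mathcal{W}_0^n$. Then $(Z^{2n}(t),t\ge0)$ is a continuous-time Markov chain on $\mathcal{W}_0^n$, started at $z$, with transition rates $$Q^q_n(z,z')=\frac{\mathcal{P}^{(n)}_{z'}(a;q)}{\mathcal{P}^{(n)}_z(a;q)}\,f_n(z,z')\quad(z'\ne z),\qquad Q^q_n(z,z)=-\sum_{i=1}^n(a_i+a_i^{-1}),$$ where, for $1\le i\le n$, $f_n(z,z+e_i)=1-q^{z_{i-1}-z_i}$ (so $f_n(z,z+e_1)=1$), $f_n(z,z-e_i)=1-q^{z_i-z_{i+1}}$ (with $z_{n+1}=0$), and $f_n(z,z')=0$ for all other $z'\neq z$. Moreover, for each $t\ge0$, the conditional law of $\mathbf{Z}(t)$ given $\{Z^{2n}(s),s\le t\}$ is $M^n_{a,q}(\cdot;Z^{2n}(t))$. -/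

import Mathlib

open MeasureTheory
open scoped NNReal

namespace Berele

/-! ### Partitions and symplectic Gelfand–Tsetlin patterns

Rows of integers are 1-indexed and extended by zero, so that the convention `x_{m+1} = 0` for a
row `x = (x_1, ..., x_m)` holds by definition. -/

/-- Integer partitions `z_1 ≥ ... ≥ z_n ≥ 0` with at most `n` parts. -/
@[ext] structure Shape (n : ℕ) where
  part : ℕ → ℤ
  anti : ∀ i, 1 ≤ i → part (i + 1) ≤ part i
  nonneg : ∀ i, 0 ≤ part i
  support : ∀ i, ¬ (1 ≤ i ∧ i ≤ n) → part i = 0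

/-- The interlacing `x ⪯ y` of two rows: `y_1 ≥ x_1 ≥ y_2 ≥ x_2 ≥ ...`. -/
def Interlaced (x y : ℕ → ℤ) : Prop := ∀ i, 1 ≤ i → y (i + 1) ≤ x i ∧ x i ≤ y i

/-- Integer symplectic Gelfand–Tsetlin patterns `(z^1, ..., z^{2n})`: levels `2l - 1` and `2l` have
`l` nonnegative entries, and consecutive levels interlace. Here `entry k i` is `z^k_i`. -/
@[ext] structure Pattern (n : ℕ) where
  entry : ℕ → ℕ → ℤ
  nonneg : ∀ k i, 0 ≤ entry k i
  support : ∀ k i, ¬ (1 ≤ k ∧ k ≤ 2 * n ∧ 1 ≤ i ∧ i ≤ (k + 1) / 2) → entry k i = 0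
  interlaced : ∀ k, 1 ≤ k → k < 2 * n → Interlaced (entry k) (entry (k + 1))

/-- The bottom row `z^{2n}` of a pattern. -/
def Pattern.shape {n : ℕ} (z : Pattern n) : Shape n where
  part := z.entry (2 * n)
  anti := by
    intro i hi
    rcases Nat.eq_zero_or_pos n with hn | hn
    · rw [z.support (2 * n) i (by omega), z.support (2 * n) (i + 1) (by omega)]
    · have h := z.interlaced (2 * n - 1) (by omega) (by omega) i hi
      rw [Nat.sub_add_cancel (by omega : 1 ≤ 2 * n)] at h
      exact h.1.trans h.2
  nonneg := z.nonneg (2 * n)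
  support := by
    intro i hi
    exact z.support (2 * n) i (by omega)

/-- Both countable state spaces carry the discrete sigma-algebra. -/
instance (n : ℕ) : MeasurableSpace (Shape n) := ⊤

instance (n : ℕ) : MeasurableSpace (Pattern n) := ⊤

/-! ### Continuous-time Markov chains on a discrete state space -/

/-- `P` is an (honest) transition semigroup with rate matrix `Q`: the matrices `P t`, `t ≥ 0`, are
stochastic, satisfy the Chapman–Kolmogorov equations, start from the identity, and solve the
Kolmogorov backward equation `P' = Q P`; at `t = 0` the last condition says `P'(0) = Q`. -/
structure IsTransitionSemigroup {S : Type*} (Q : S → S → ℝ) (P : ℝ → S → S → ℝ) : Prop where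
  nonneg : ∀ t, 0 ≤ t → ∀ x y, 0 ≤ P t x y
  row_sum : ∀ t, 0 ≤ t → ∀ x, HasSum (fun y => P t x y) 1
  zero_same : ∀ x, P 0 x x = 1
  zero_ne : ∀ x y, x ≠ y → P 0 x y = 0
  add : ∀ s t, 0 ≤ s → 0 ≤ t → ∀ x z, HasSum (fun y => P s x y * P t y z) (P (s + t) x z)
  backward : ∀ t, 0 ≤ t → ∀ x z, ∃ d : ℝ, HasSum (fun y => Q x y * P t y z) d ∧
    HasDerivWithinAt (fun s => P s x z) d (Set.Ici 0) t

/-- The sigma-algebra `σ(X_s, s ≤ t)`. -/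
abbrev history {Ω S : Type*} [MeasurableSpace S] (X : ℝ≥0 → Ω → S) (t : ℝ≥0) : MeasurableSpace Ω :=
  ⨆ s : Set.Iic t, MeasurableSpace.comap (X s) inferInstance

/-- Under `μ`, the process `X` is a continuous-time Markov chain with transition rates `Q`: its
paths are almost surely right-continuous step functions with left limits (for the discrete
topology), and it has the Markov property with respect to its own history, with a transition
semigroup whose rate matrix is `Q`. -/
structure IsMarkovChain {Ω S : Type*} [MeasurableSpace Ω] [MeasurableSpace S]
    (μ : Measure Ω) (X : ℝ≥0 → Ω → S) (Q : S → S → ℝ) : Prop where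
  measurable : ∀ t, Measurable (X t)
  right_cont : ∀ᵐ ω ∂μ, ∀ t, ∀ᶠ s in nhdsWithin t (Set.Ioi t), X s ω = X t ω
  left_lim : ∀ᵐ ω ∂μ, ∀ t, ∃ x, ∀ᶠ s in nhdsWithin t (Set.Iio t), X s ω = x
  markov : ∃ P : ℝ → S → S → ℝ, IsTransitionSemigroup Q P ∧
    ∀ (s t : ℝ≥0) (y : S),
      μ[(X (s + t) ⁻¹' {y}).indicator (fun _ => (1 : ℝ)) | history X s]
        =ᵐ[μ] fun ω => P t (X s ω) y

/-! ### The `q`-deformed Berele dynamics -/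

/-- `r_i(y; x) = q^{y_i - x_i} (1 - q^{x_{i-1} - y_i}) / (1 - q^{x_{i-1} - x_i})`, `x_0 = ∞`. -/
noncomputable def pushProb (q : ℝ) (i : ℕ) (y x : ℕ → ℤ) : ℝ :=
  if i = 1 then q ^ (y 1 - x 1)
  else q ^ (y i - x i) * ((1 - q ^ (x (i - 1) - y i)) / (1 - q ^ (x (i - 1) - x i)))

/-- `l_i(y; x) = q^{x_i - y_{i+1}} (1 - q^{y_{i+1} - x_{i+1}}) / (1 - q^{x_i - x_{i+1}})`. -/
noncomputable def pullProb (q : ℝ) (i : ℕ) (y x : ℕ → ℤ) : ℝ :=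
  q ^ (x i - y (i + 1)) * ((1 - q ^ (y (i + 1) - x (i + 1))) / (1 - q ^ (x i - x (i + 1))))

/-- Replace `u^k_i` by `u^k_i + c`. -/
def move (u : ℕ → ℕ → ℤ) (k i : ℕ) (c : ℤ) : ℕ → ℕ → ℤ :=
  fun k' i' => if k' = k ∧ i' = i then u k' i' + c else u k' i'

/-- Direction of the jump that a particle attempts. -/
inductive Dir
  | right
  | left

open Classical in
/-- `cascade q d δ k i u w` is the probability that the array `u` is turned into the array `w` when
the particle at position `(k, i)` attempts a jump in direction `δ` and there are `d` levels below
level `k`. Levels `k, k + 1, ...` of `u` are still as they were just before the jump time. -/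
noncomputable def cascade (q : ℝ) :
    ℕ → Dir → ℕ → ℕ → (ℕ → ℕ → ℤ) → (ℕ → ℕ → ℤ) → ℝ
  | 0, Dir.right, k, i, u, w => if w = move u k i 1 then 1 else 0
  | 0, Dir.left, k, i, u, w => if w = move u k i (-1) then 1 else 0
  | d + 1, Dir.right, k, i, u, w =>
      let r := pushProb q i (u (k + 1)) (u k)
      if k + 1 = 2 * i then
        -- the last particle of an odd level: otherwise the jump is suppressed
        r * cascade q d Dir.right (k + 1) i (move u k i 1) w
          + (1 - r) * cascade q d Dir.left (k + 1) i u w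
      else
        r * cascade q d Dir.right (k + 1) i (move u k i 1) w
          + (1 - r) * cascade q d Dir.right (k + 1) (i + 1) (move u k i 1) w
  | d + 1, Dir.left, k, i, u, w =>
      let l := pullProb q i (u (k + 1)) (u k)
      l * cascade q d Dir.left (k + 1) (i + 1) (move u k i (-1)) w
        + (1 - l) * cascade q d Dir.left (k + 1) i (move u k i (-1)) w

/-- The probability that the pattern becomes `w` when the clock of the particle `Z^k_1` rings in
the pattern `z`. -/
noncomputable def ringProb (q : ℝ) {n : ℕ} (k : ℕ) (z w : Pattern n) : ℝ :=
  cascade q (2 * n - k) Dir.right k 1 z.entry w.entry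

open Classical in
/-- The transition rate matrix of the `q`-deformed Berele dynamics: for `1 ≤ l ≤ n` the clocks of
`Z^{2l-1}_1` and `Z^{2l}_1` ring at rates `a_l` and `a_l⁻¹`. -/
noncomputable def patternRate (q : ℝ) (a : ℕ → ℝ) {n : ℕ} (z w : Pattern n) : ℝ :=
  ∑ l ∈ Finset.Icc 1 n,
    (a l * (ringProb q (2 * l - 1) z w - if z = w then 1 else 0)
      + (a l)⁻¹ * (ringProb q (2 * l) z w - if z = w then 1 else 0))

/-! ### Weights and the rates of the shape -/

/-- The `q`-factorial `∏_{k=1}^m (1 - q^k) / (1 - q)`. -/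
noncomputable def qFactorial (q : ℝ) (m : ℕ) : ℝ :=
  ∏ k ∈ Finset.Icc 1 m, (1 - q ^ k) / (1 - q)

/-- The `q`-binomial coefficient, for `0 ≤ k ≤ m`, and zero otherwise. -/
noncomputable def qBinom (q : ℝ) (m k : ℤ) : ℝ :=
  if 0 ≤ k ∧ k ≤ m then
    qFactorial q m.toNat / (qFactorial q k.toNat * qFactorial q (m - k).toNat)
  else 0

/-- The factor `Λ_{k-1,k}(x, y, z)` with parameter `b`, for rows `x`, `y`, `z` with `k - 1`, `k`
and `k` entries. -/
noncomputable def levelWeight (q b : ℝ) (k : ℕ) (x y z : ℕ → ℤ) : ℝ :=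
  b ^ (2 * (∑ i ∈ Finset.Icc 1 k, y i) - (∑ i ∈ Finset.Icc 1 (k - 1), x i)
      - ∑ i ∈ Finset.Icc 1 k, z i)
    * (∏ i ∈ Finset.Icc 1 (k - 1),
        qBinom q (y i - y (i + 1)) (y i - x i) * qBinom q (z i - z (i + 1)) (z i - y i))
    * qBinom q (z k) (z k - y k)

/-- The weight of a pattern. -/
noncomputable def weight (q : ℝ) (a : ℕ → ℝ) {n : ℕ} (z : Pattern n) : ℝ :=
  ∏ k ∈ Finset.Icc 1 n,
    levelWeight q (a k) k (z.entry (2 * k - 2)) (z.entry (2 * k - 1)) (z.entry (2 * k))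

/-- `P^{(n)}_z(a; q)`: the sum of the weights of the (finitely many) patterns of shape `z`. -/
noncomputable def shapeFun (q : ℝ) (a : ℕ → ℝ) {n : ℕ} (z : Shape n) : ℝ :=
  ∑' p : {p : Pattern n // p.shape = z}, weight q a p.1

open Classical in
/-- The law `M^n_{a,q}(·; z)` on patterns: proportional to the weight on patterns of shape `z`. -/
noncomputable def gibbs (q : ℝ) (a : ℕ → ℝ) {n : ℕ} (z : Shape n) : Measure (Pattern n) :=
  Measure.sum fun p : Pattern n =>
    ENNReal.ofReal (if p.shape = z then weight q a p / shapeFun q a z else 0) • Measure.dirac p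

open Classical in
/-- `f_n(z, z')`: equal to `1 - q^{z_{i-1} - z_i}` if `z' = z + e_i` (with `z_0 = ∞`), to
`1 - q^{z_i - z_{i+1}}` if `z' = z - e_i` (with `z_{n+1} = 0`), and to `0` otherwise. -/
noncomputable def stepFactor (q : ℝ) {n : ℕ} (z z' : Shape n) : ℝ :=
  ∑ i ∈ Finset.Icc 1 n,
    ((if z'.part = z.part + Pi.single i 1 then
        (if i = 1 then 1 else 1 - q ^ (z.part (i - 1) - z.part i)) else 0)
      + (if z'.part = z.part - Pi.single i 1 then 1 - q ^ (z.part i - z.part (i + 1)) else 0))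

open Classical in
/-- The transition rate matrix `Q^q_n` on partitions. -/
noncomputable def shapeRate (q : ℝ) (a : ℕ → ℝ) {n : ℕ} (z z' : Shape n) : ℝ :=
  if z' = z then -∑ i ∈ Finset.Icc 1 n, (a i + (a i)⁻¹)
  else shapeFun q a z' / shapeFun q a z * stepFactor q z z'

end Berele

open Berele

/-! The shape is a function of the pattern chain, and it is Markov because the two rate matrices are
intertwined by the Gibbs link `M`: if `Q` drives patterns and `Q'` drives shapes, then `M Q = Q' M`
(`isIntertwined`). This passes to semigroups: both sides of `M P_t = P'_t M`, with `P'_t` the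
averaged semigroup, solve the backward equation of `Q'`, whose bounded solutions are unique because
the row sums of `Q'` are bounded (`semigroup_intertwine`). The Markov property then carries the
conditional law `M` from one time to the next, hence to all cylinder events, and a π-λ argument
extends it to the history of the shape (`IsMarkovChain.image`).

The combinatorial heart is the balance identity `sum_fiber_weight_mul_ringProb`: for a target `w`,
the weighted rates of all rings that lead from shape `z` to `w` add up to the weight of `w` times
`f_n`. The weight is a product over pairs of consecutive levels, with parameter `a_l` at level `2l -
1` and its inverse at level `2l`. The rows of the source are summed out one by one, in increasing
order of the level. The invariant is `levelRate`: once the rows above level `k` are summed out, they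
have been replaced by those of `w`, and a jump at level `k` carries the factor `upRate` or
`downRate` times the weight of levels `k - 1, k` after the jump. Summing out row `k` reproduces this
form at level `k + 1` (`sum_levelRate_update`). A cascade no longer changes a row it has left, so
each attempted jump has at most two possible source rows, and what remains are the absorption and
Pascal rules for q-binomials.

The wall produces one defect. On level `2p + 1` the last entry has no partner on level `2p` that
could pull it left, so its left rate in `leftRate` is too small by an explicit term. In the next
step, suppressed right jumps turn into left jumps and supply exactly the missing flow, because the
parameters of levels `2p + 1` and `2p + 2` are inverse to each other (`rowWeight_suppressed`). The
bottom level `2n` is even, so no defect is left and the rates are those of `f_n`. -/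

namespace Berele

/-! ### Uniqueness for the backward equation -/

/-- A bounded solution of the linear system `g' = Q g` with a rate matrix with finite rows and
uniformly bounded row sums vanishes if it vanishes at time zero. -/
theorem eq_zero_of_backward_equation {T : Type*} {Q : T → T → ℝ} {N : T → Finset T} {C B : ℝ}
    (hC : ∀ z, ∑ z' ∈ N z, |Q z z'| ≤ C) {g : ℝ → T → ℝ}
    (hB : ∀ t, 0 ≤ t → ∀ z, |g t z| ≤ B) (h0 : ∀ z, g 0 z = 0)
    (hd : ∀ t, 0 ≤ t → ∀ z,
      HasDerivWithinAt (fun s => g s z) (∑ z' ∈ N z, Q z z' * g t z') (Set.Ici 0) t)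
    {t : ℝ} (ht : 0 ≤ t) (z : T) : g t z = 0 := by
  have hC0 : 0 ≤ C := (Finset.sum_nonneg fun _ _ => abs_nonneg _).trans (hC z)
  have hB0 : 0 ≤ B := (abs_nonneg _).trans (hB t ht z)
  -- Each use of the equation gains one integration, which improves the bound `B` to the `k`-th
  -- Taylor term of `B e^{Cs}`; these terms tend to zero.
  have key : ∀ (k : ℕ) (s : ℝ), 0 ≤ s → ∀ z, |g s z| ≤ B * ((C * s) ^ k / k.factorial) := by
    intro k
    induction k with
    | zero => intro s hs z; simpa using hB s hs z
    | succ k ih =>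
      intro s hs z
      have hder : ∀ x : ℝ, HasDerivAt (fun s : ℝ => B * ((C * s) ^ (k + 1) / (k + 1).factorial))
          (C * (B * ((C * x) ^ k / k.factorial))) x := by
        intro x
        have h1 : HasDerivAt (fun s : ℝ => (C * s) ^ (k + 1)) (((k + 1 : ℕ) : ℝ) * (C * x) ^ k * C) x := by
          have := ((hasDerivAt_id x).const_mul C).fun_pow (k + 1)
          simp only [id, mul_one, Nat.add_sub_cancel] at this
          exact this
        refine ((h1.div_const ((k + 1).factorial : ℝ)).const_mul B).congr_deriv ?_
        rw [Nat.factorial_succ]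
        have : ((k.factorial : ℕ) : ℝ) ≠ 0 := by exact_mod_cast k.factorial_ne_zero
        push_cast
        field_simp
      refine image_norm_le_of_norm_deriv_right_le_deriv_boundary (f := fun s => g s z) (a := 0) (b := s)
        (f' := fun t => ∑ z' ∈ N z, Q z z' * g t z')
        (fun x hx => ((hd x hx.1 z).mono Set.Icc_subset_Ici_self).continuousWithinAt)
        (fun x hx => (hd x hx.1 z).mono (Set.Ici_subset_Ici.2 hx.1)) ?_ hder ?_ ⟨hs, le_rfl⟩
      · simp [h0]
      · intro x hx
        rw [Real.norm_eq_abs]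
        calc |∑ z' ∈ N z, Q z z' * g x z'| ≤ ∑ z' ∈ N z, |Q z z' * g x z'| :=
              Finset.abs_sum_le_sum_abs _ _
          _ ≤ ∑ z' ∈ N z, |Q z z'| * (B * ((C * x) ^ k / k.factorial)) := by
              refine Finset.sum_le_sum fun z' _ => ?_
              rw [abs_mul]
              exact mul_le_mul_of_nonneg_left (ih x hx.1 z') (abs_nonneg _)
          _ ≤ C * (B * ((C * x) ^ k / k.factorial)) := by
              rw [← Finset.sum_mul]
              have := hx.1
              exact mul_le_mul_of_nonneg_right (hC z) (by positivity)
  have hlim := (FloorSemiring.tendsto_pow_div_factorial_atTop (C * t)).const_mul B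
  rw [mul_zero] at hlim
  exact abs_nonpos_iff.1 (ge_of_tendsto' hlim fun k => key k t ht z)

/-! ### Links and intertwined semigroups -/

/-- A family of probability vectors `M z` on the finite fibres `F z` of a map `φ`. -/
structure IsLink {S T : Type*} (φ : S → T) (F : T → Finset S) (M : T → S → ℝ) : Prop where
  mem_fiber : ∀ z x, x ∈ F z ↔ φ x = z
  nonneg : ∀ z x, 0 ≤ M z x
  zero_of_ne : ∀ z x, φ x ≠ z → M z x = 0
  sum_eq_one : ∀ z, ∑ x ∈ F z, M z x = 1

/-- The rate matrices `Q` and `Q'` are intertwined by the link `M`, and have finite rows and bounded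
row sums respectively. -/
structure IsIntertwined {S T : Type*} (φ : S → T) (F : T → Finset S) (M : T → S → ℝ)
    (Q : S → S → ℝ) (Q' : T → T → ℝ) : Prop extends IsLink φ F M where
  intertwine : ∀ z y, ∑ x ∈ F z, M z x * Q x y = Q' z (φ y) * M (φ y) y
  finite_rows : ∀ z, {z' | Q' z z' ≠ 0}.Finite
  bounded : ∃ C : ℝ, ∀ (x : S) (s : Finset S), ∑ y ∈ s, |Q x y| ≤ C

/-- The transition matrices of the image chain. -/
noncomputable def imageSemigroup {S T : Type*} (F : T → Finset S) (M : T → S → ℝ)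
    (P : ℝ → S → S → ℝ) (t : ℝ) (z z' : T) : ℝ :=
  ∑ x ∈ F z, M z x * ∑ y ∈ F z', P t x y

theorem IsTransitionSemigroup.le_one {S : Type*} {Q : S → S → ℝ} {P : ℝ → S → S → ℝ}
    (hP : IsTransitionSemigroup Q P) {t : ℝ} (ht : 0 ≤ t) (x y : S) : P t x y ≤ 1 :=
  le_hasSum (hP.row_sum t ht x) y fun z _ => hP.nonneg t ht x z

theorem IsTransitionSemigroup.sum_le_one {S : Type*} {Q : S → S → ℝ} {P : ℝ → S → S → ℝ}
    (hP : IsTransitionSemigroup Q P) {t : ℝ} (ht : 0 ≤ t) (x : S) (s : Finset S) :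
    ∑ y ∈ s, P t x y ≤ 1 :=
  sum_le_hasSum s (fun z _ => hP.nonneg t ht x z) (hP.row_sum t ht x)

namespace IsLink

variable {S T : Type*} {φ : S → T} {F : T → Finset S} {M : T → S → ℝ}

theorem sum_mul_le (h : IsLink φ F M) {f : S → ℝ} {c : ℝ} (hf : ∀ x, f x ≤ c) (z : T) :
    ∑ x ∈ F z, M z x * f x ≤ c := by
  calc ∑ x ∈ F z, M z x * f x ≤ ∑ x ∈ F z, M z x * c :=
        Finset.sum_le_sum fun x _ => mul_le_mul_of_nonneg_left (hf x) (h.nonneg z x)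
    _ = c := by rw [← Finset.sum_mul, h.sum_eq_one, one_mul]

theorem le_one (h : IsLink φ F M) (z : T) (x : S) : M z x ≤ 1 := by
  by_cases hx : φ x = z
  · rw [← h.sum_eq_one z]
    exact Finset.single_le_sum (fun y _ => h.nonneg z y) ((h.mem_fiber z x).2 hx)
  · rw [h.zero_of_ne z x hx]; exact zero_le_one

theorem pairwiseDisjoint (h : IsLink φ F M) (s : Set T) : s.PairwiseDisjoint F := by
  intro z _ z' _ hzz
  refine Finset.disjoint_left.2 fun x hx hx' => hzz ?_
  rw [← (h.mem_fiber z x).1 hx, (h.mem_fiber z' x).1 hx']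

/-- Summation over the source space can be done fibre by fibre. -/
theorem hasSum_fiber (h : IsLink φ F M) {f : S → ℝ} {a : ℝ} (hf : HasSum f a) :
    HasSum (fun z => ∑ x ∈ F z, f x) a := by
  have h1 := (Equiv.sigmaFiberEquiv φ).hasSum_iff.2 hf
  refine h1.sigma fun z => ?_
  have h2 := Finset.hasSum (F z) f
  let e : {x // x ∈ F z} ≃ {x // φ x = z} := Equiv.subtypeEquivRight (h.mem_fiber z)
  rw [← e.hasSum_iff]
  exact h2

end IsLink

namespace IsIntertwined

variable {S T : Type*} {φ : S → T} {F : T → Finset S} {M : T → S → ℝ}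
  {Q : S → S → ℝ} {Q' : T → T → ℝ} {P : ℝ → S → S → ℝ}

/-- Since each `M z'` has mass one, a row of `Q'` has the same absolute sum as the corresponding row
of `M Q`, which is an average of rows of `Q`. -/
theorem bounded_image (h : IsIntertwined φ F M Q Q') :
    ∃ C : ℝ, ∀ (z : T) (s : Finset T), ∑ z' ∈ s, |Q' z z'| ≤ C := by
  classical
  obtain ⟨C, hC⟩ := h.bounded
  refine ⟨C, fun z s => ?_⟩
  calc ∑ z' ∈ s, |Q' z z'| = ∑ z' ∈ s, ∑ y ∈ F z', |∑ x ∈ F z, M z x * Q x y| := by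
        refine Finset.sum_congr rfl fun z' _ => ?_
        rw [← mul_one |Q' z z'|, ← h.sum_eq_one z', Finset.mul_sum]
        refine Finset.sum_congr rfl fun y hy => ?_
        rw [h.intertwine, (h.mem_fiber z' y).1 hy, abs_mul, abs_of_nonneg (h.nonneg z' y)]
    _ = ∑ y ∈ s.biUnion F, |∑ x ∈ F z, M z x * Q x y| := by
        rw [Finset.sum_biUnion (h.pairwiseDisjoint _)]
    _ ≤ ∑ y ∈ s.biUnion F, ∑ x ∈ F z, M z x * |Q x y| := by
        refine Finset.sum_le_sum fun y _ => (Finset.abs_sum_le_sum_abs _ _).trans_eq ?_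
        refine Finset.sum_congr rfl fun x _ => ?_
        rw [abs_mul, abs_of_nonneg (h.nonneg z x)]
    _ = ∑ x ∈ F z, M z x * ∑ y ∈ s.biUnion F, |Q x y| := by
        rw [Finset.sum_comm]; simp_rw [Finset.mul_sum]
    _ ≤ C := h.sum_mul_le (f := fun x => ∑ y ∈ s.biUnion F, |Q x y|) (fun x => hC x _) z

/-- The averages `∑_x M z x P_t(x, y)` solve the backward equation with rate matrix `Q'`. -/
theorem hasDeriv_average (h : IsIntertwined φ F M Q Q') (hP : IsTransitionSemigroup Q P)
    {t : ℝ} (ht : 0 ≤ t) (z : T) (w : S) :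
    HasDerivWithinAt (fun s => ∑ x ∈ F z, M z x * P s x w)
      (∑ z' ∈ (h.finite_rows z).toFinset, Q' z z' * ∑ y ∈ F z', M z' y * P t y w)
      (Set.Ici 0) t := by
  choose d hd1 hd2 using fun x => hP.backward t ht x w
  have h1 : HasDerivWithinAt (fun s => ∑ x ∈ F z, M z x * P s x w) (∑ x ∈ F z, M z x * d x)
      (Set.Ici 0) t := by
    refine HasDerivWithinAt.fun_sum fun x _ => (hd2 x).const_mul _
  have h2 : HasSum (fun y => ∑ x ∈ F z, M z x * (Q x y * P t y w)) (∑ x ∈ F z, M z x * d x) :=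
    hasSum_sum fun x _ => (hd1 x).mul_left _
  have h3 := h.hasSum_fiber h2
  -- Grouped by fibres, the backward sum contains `M Q`, which the intertwining replaces by `Q' M`.
  have h4 : ∀ z', ∑ y ∈ F z', ∑ x ∈ F z, M z x * (Q x y * P t y w)
      = Q' z z' * ∑ y ∈ F z', M z' y * P t y w := by
    intro z'
    rw [Finset.mul_sum]
    refine Finset.sum_congr rfl fun y hy => ?_
    have := h.intertwine z y
    rw [(h.mem_fiber z' y).1 hy] at this
    rw [← mul_assoc, ← this, Finset.sum_mul]
    exact Finset.sum_congr rfl fun x _ => (mul_assoc _ _ _).symm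
  simp_rw [h4] at h3
  have h5 := hasSum_sum_of_ne_finset_zero
    (f := fun z' => Q' z z' * ∑ y ∈ F z', M z' y * P t y w) (s := (h.finite_rows z).toFinset) (L := .unconditional T) (by
      intro b hb
      have : Q' z b = 0 := by simpa using hb
      simp [this])
  rw [← h3.unique h5]
  exact h1

/-- For fixed `w`, both sides are functions of `(t, z)` with values in `[0, 1]` that solve the
backward equation of `Q'` and equal `M z w` at time zero; uniqueness identifies them. -/
theorem semigroup_intertwine (h : IsIntertwined φ F M Q Q') (hP : IsTransitionSemigroup Q P)
    {t : ℝ} (ht : 0 ≤ t) (z : T) (w : S) :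
    ∑ x ∈ F z, M z x * P t x w = imageSemigroup F M P t z (φ w) * M (φ w) w := by
  classical
  obtain ⟨C, hC⟩ := h.bounded_image
  have key := eq_zero_of_backward_equation (Q := Q') (N := fun z => (h.finite_rows z).toFinset)
    (C := C) (B := 1)
    (fun z => hC z _) (g := fun t z => ∑ x ∈ F z, M z x * P t x w
      - imageSemigroup F M P t z (φ w) * M (φ w) w) ?_ ?_ ?_ ht z
  · exact sub_eq_zero.1 key
  · intro t ht z
    have h1 : 0 ≤ ∑ x ∈ F z, M z x * P t x w :=
      Finset.sum_nonneg fun x _ => mul_nonneg (h.nonneg z x) (hP.nonneg t ht x w)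
    have h2 : ∑ x ∈ F z, M z x * P t x w ≤ 1 :=
      h.sum_mul_le (f := fun x => P t x w) (fun x => hP.le_one ht x w) z
    have h3 : 0 ≤ imageSemigroup F M P t z (φ w) :=
      Finset.sum_nonneg fun x _ => mul_nonneg (h.nonneg z x)
        (Finset.sum_nonneg fun y _ => hP.nonneg t ht x y)
    have h4 : imageSemigroup F M P t z (φ w) ≤ 1 :=
      h.sum_mul_le (f := fun x => ∑ y ∈ F (φ w), P t x y) (fun x => hP.sum_le_one ht x _) z
    have h5 := mul_nonneg h3 (h.nonneg (φ w) w)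
    have h6 := mul_le_one₀ h4 (h.nonneg (φ w) w) (h.le_one (φ w) w)
    rw [abs_le]
    constructor <;> linarith
  · intro z
    have h1 : ∀ y, ∑ x ∈ F z, M z x * P 0 x y = M z y := by
      intro y
      by_cases hy : y ∈ F z
      · rw [Finset.sum_eq_single_of_mem y hy fun x _ hx => by rw [hP.zero_ne x y hx, mul_zero],
          hP.zero_same, mul_one]
      · rw [h.zero_of_ne z y (fun hh => hy ((h.mem_fiber z y).2 hh))]
        refine Finset.sum_eq_zero fun x hx => ?_
        rw [hP.zero_ne x y (fun hh => hy (hh ▸ hx)), mul_zero]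
    have h2 : imageSemigroup F M P 0 z (φ w) = ∑ y ∈ F (φ w), M z y := by
      simp_rw [imageSemigroup, Finset.mul_sum]
      rw [Finset.sum_comm]
      simp_rw [h1]
    rw [h1, h2]
    by_cases hz : φ w = z
    · rw [hz, h.sum_eq_one, one_mul, sub_self]
    · rw [h.zero_of_ne z w hz, Finset.sum_eq_zero, zero_mul, sub_zero]
      intro y hy
      exact h.zero_of_ne z y (fun hh => hz (by rw [← hh, (h.mem_fiber _ y).1 hy]))
  · intro t ht z
    have h1 := h.hasDeriv_average hP ht z w
    have h2 : HasDerivWithinAt (fun s => imageSemigroup F M P s z (φ w) * M (φ w) w)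
        (∑ y ∈ F (φ w), (∑ z' ∈ (h.finite_rows z).toFinset,
          Q' z z' * ∑ x ∈ F z', M z' x * P t x y) * M (φ w) w) (Set.Ici 0) t := by
      have h3 := HasDerivWithinAt.fun_sum (u := F (φ w)) fun y _ =>
        (h.hasDeriv_average hP ht z y).mul_const (M (φ w) w)
      refine h3.congr_of_mem (fun s _ => ?_) ht
      simp_rw [imageSemigroup, Finset.mul_sum]
      rw [Finset.sum_comm, Finset.sum_mul]
    refine (h1.fun_sub h2).congr_deriv ?_
    rw [← Finset.sum_mul, Finset.sum_comm, Finset.sum_mul, ← Finset.sum_sub_distrib]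
    refine Finset.sum_congr rfl fun z' _ => ?_
    rw [← Finset.mul_sum, mul_assoc, ← mul_sub, imageSemigroup]
    simp_rw [Finset.mul_sum]
    rw [Finset.sum_comm]

/-- Averaging preserves every axiom directly except Chapman–Kolmogorov, where the intertwining of
semigroups is needed to restart from the link at the intermediate time. -/
theorem isTransitionSemigroup (h : IsIntertwined φ F M Q Q') (hP : IsTransitionSemigroup Q P) :
    IsTransitionSemigroup Q' (imageSemigroup F M P) where
  nonneg t ht z z' := Finset.sum_nonneg fun x _ => mul_nonneg (h.nonneg z x)
        (Finset.sum_nonneg fun y _ => hP.nonneg t ht x y)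
  row_sum t ht z := by
    have h1 : HasSum (fun y => ∑ x ∈ F z, M z x * P t x y) (∑ x ∈ F z, M z x * 1) :=
      hasSum_sum fun x _ => (hP.row_sum t ht x).mul_left _
    simp_rw [mul_one, h.sum_eq_one] at h1
    convert h.hasSum_fiber h1 using 2 with z'
    simp_rw [imageSemigroup, Finset.mul_sum]
    rw [Finset.sum_comm]
  zero_same z := by
    rw [imageSemigroup, ← h.sum_eq_one z]
    refine Finset.sum_congr rfl fun x hx => ?_
    rw [Finset.sum_eq_single_of_mem x hx fun y _ hy => hP.zero_ne x y hy.symm, hP.zero_same, mul_one]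
  zero_ne z z' hz := by
    refine Finset.sum_eq_zero fun x hx => ?_
    rw [Finset.sum_eq_zero fun y hy => ?_, mul_zero]
    refine hP.zero_ne x y fun hh => hz ?_
    rw [← (h.mem_fiber z x).1 hx, ← (h.mem_fiber z' y).1 hy, hh]
  add s t hs ht z z'' := by
    have h1 : HasSum (fun y => ∑ x ∈ F z, M z x * ∑ w ∈ F z'', P s x y * P t y w)
        (imageSemigroup F M P (s + t) z z'') :=
      hasSum_sum fun x _ => (hasSum_sum fun w _ => hP.add s t hs ht x w).mul_left _
    convert h.hasSum_fiber h1 using 2 with z'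
    rw [imageSemigroup.eq_1 F M P t, Finset.mul_sum]
    refine Finset.sum_congr rfl fun y hy => ?_
    have h2 := h.semigroup_intertwine hP hs z y
    rw [(h.mem_fiber z' y).1 hy] at h2
    rw [← mul_assoc, ← h2, Finset.sum_mul]
    refine Finset.sum_congr rfl fun x _ => ?_
    rw [← Finset.mul_sum, mul_assoc]
  backward t ht z z' := by
    refine ⟨_, hasSum_sum_of_ne_finset_zero (s := (h.finite_rows z).toFinset) fun b hb => ?_, ?_⟩
    · have : Q' z b = 0 := by simpa using hb
      rw [this, zero_mul]
    · have h1 := HasDerivWithinAt.fun_sum (u := F z') fun y _ => h.hasDeriv_average hP ht z y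
      refine (h1.congr_of_mem (fun s _ => ?_) ht).congr_deriv ?_
      · simp_rw [imageSemigroup, Finset.mul_sum]
        rw [Finset.sum_comm]
      · rw [Finset.sum_comm]
        refine Finset.sum_congr rfl fun w _ => ?_
        simp_rw [imageSemigroup, Finset.mul_sum]
        rw [Finset.sum_comm]

end IsIntertwined

/-! ### Histories and propagation of the conditional law -/

theorem measurable_history {Ω S : Type*} [MeasurableSpace S] (X : ℝ≥0 → Ω → S) {s t : ℝ≥0}
    (hst : s ≤ t) : Measurable[history X t] (X s) :=
  Measurable.of_comap_le
    (le_iSup (fun s : Set.Iic t => MeasurableSpace.comap (X s) inferInstance) ⟨s, hst⟩)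

theorem history_le {Ω S : Type*} [mΩ : MeasurableSpace Ω] [MeasurableSpace S] {X : ℝ≥0 → Ω → S}
    (hX : ∀ t, Measurable (X t)) (t : ℝ≥0) : history X t ≤ mΩ :=
  iSup_le fun s => (hX s).comap_le

theorem history_comp_le {Ω S T : Type*} [MeasurableSpace S] [MeasurableSpace T]
    (X : ℝ≥0 → Ω → S) {φ : S → T} (hφ : Measurable φ) (t : ℝ≥0) :
    history (fun s ω => φ (X s ω)) t ≤ history X t :=
  iSup_le fun s => (hφ.comp (measurable_history X s.2)).comap_le

/-- Supplies the π-system of cylinder events from which identities are extended to the whole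
history. -/
theorem history_eq_generateFrom {Ω S : Type*} [MeasurableSpace S] (X : ℝ≥0 → Ω → S) (t : ℝ≥0) :
    history X t = MeasurableSpace.generateFrom (piiUnionInter
      (fun s => {A | MeasurableSet[MeasurableSpace.comap (X s) inferInstance] A}) (Set.Iic t)) := by
  rw [generateFrom_piiUnionInter_measurableSet, iSup_subtype']

/-- On the event `G`, the conditional law of `Z t` given its image under `φ` is `M`. -/
def IsConditionedAt {Ω S T : Type*} [MeasurableSpace Ω] (μ : Measure Ω) (Z : ℝ≥0 → Ω → S)
    (φ : S → T) (M : T → S → ℝ) (t : ℝ≥0) (G : Set Ω) : Prop :=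
  ∀ y, μ.real (G ∩ Z t ⁻¹' {y}) = M (φ y) y * μ.real (G ∩ (fun ω => φ (Z t ω)) ⁻¹' {φ y})

theorem IsLink.abs_sum_mul_le {S T : Type*} {φ : S → T} {F : T → Finset S} {M : T → S → ℝ}
    (h : IsLink φ F M) {f : S → ℝ} {c : ℝ} (hf : ∀ x, |f x| ≤ c) (z : T) :
    |∑ x ∈ F z, M z x * f x| ≤ c := by
  refine (Finset.abs_sum_le_sum_abs _ _).trans ?_
  simp_rw [abs_mul, abs_of_nonneg (h.nonneg _ _)]
  exact h.sum_mul_le (f := fun x => |f x|) hf z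

theorem setIntegral_indicator_one_eq {Ω : Type*} [MeasurableSpace Ω] {μ : Measure Ω} {A G : Set Ω} (hA : MeasurableSet A) :
    ∫ ω in G, A.indicator (fun _ => (1 : ℝ)) ω ∂μ = μ.real (G ∩ A) := by
  rw [setIntegral_indicator hA, setIntegral_const, smul_eq_mul, mul_one]

/-- An event that depends on `φ (Z t)` alone contains the whole fibre event of `y` or is disjoint
from it. -/
theorem IsConditionedAt.inter_preimage {Ω S T : Type*} [MeasurableSpace Ω] {μ : Measure Ω}
    {Z : ℝ≥0 → Ω → S} {φ : S → T} {M : T → S → ℝ} {t : ℝ≥0} {G : Set Ω} (hcond : IsConditionedAt μ Z φ M t G)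
    (B : Set T) : IsConditionedAt μ Z φ M t (G ∩ (fun ω => φ (Z t ω)) ⁻¹' B) := by
  intro y
  by_cases hy : φ y ∈ B
  · have e : ∀ A : Set Ω, (∀ ω ∈ A, φ (Z t ω) = φ y) →
        G ∩ (fun ω => φ (Z t ω)) ⁻¹' B ∩ A = G ∩ A := by
      intro A hA
      rw [Set.inter_assoc, Set.inter_eq_self_of_subset_right (s := _ ⁻¹' B)]
      intro ω hω
      rwa [Set.mem_preimage, hA ω hω]
    rw [e (Z t ⁻¹' {y}) fun ω hω => congrArg φ hω,
      e ((fun ω => φ (Z t ω)) ⁻¹' {φ y}) fun ω hω => hω]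
    exact hcond y
  · have e1 : G ∩ (fun ω => φ (Z t ω)) ⁻¹' B ∩ Z t ⁻¹' {y} = ∅ := by
      refine Set.eq_empty_of_forall_notMem fun ω hω => hy ?_
      have := hω.1.2
      rwa [Set.mem_preimage, show Z t ω = y from hω.2] at this
    have e2 : G ∩ (fun ω => φ (Z t ω)) ⁻¹' B ∩ (fun ω => φ (Z t ω)) ⁻¹' {φ y} = ∅ := by
      refine Set.eq_empty_of_forall_notMem fun ω hω => hy ?_
      have := hω.1.2
      rwa [Set.mem_preimage, show φ (Z t ω) = φ y from hω.2] at this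
    rw [e1, e2]
    simp

section

variable {S T : Type*} [MeasurableSpace S] [MeasurableSpace T] [DiscreteMeasurableSpace S]
  [DiscreteMeasurableSpace T] [Countable T]
  {φ : S → T} {F : T → Finset S} {M : T → S → ℝ} {Q : S → S → ℝ} {Q' : T → T → ℝ}
  {P : ℝ → S → S → ℝ}
  {Ω : Type*} [MeasurableSpace Ω] {μ : Measure Ω} [IsProbabilityMeasure μ] {Z : ℝ≥0 → Ω → S}

theorem integrable_comp_of_bounded {f : S → ℝ} {c : ℝ} (hf : ∀ x, |f x| ≤ c) {Y : Ω → S}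
    (hY : Measurable Y) : Integrable (fun ω => f (Y ω)) μ :=
  Integrable.of_bound ((Measurable.of_discrete (f := f)).comp hY).aestronglyMeasurable c
    (Filter.Eventually.of_forall fun _ => hf _)

/-- `G` splits into countably many pieces according to the value of `φ (Z t)`; on each piece `f (Z
t)` is a finite combination of indicators of single states, to which the hypothesis applies. -/
theorem IsConditionedAt.setIntegral_eq (h : IsLink φ F M) (hZ : ∀ t, Measurable (Z t)) {t : ℝ≥0}
    {G : Set Ω} (hG : MeasurableSet G) (hcond : IsConditionedAt μ Z φ M t G) {f : S → ℝ} {c : ℝ}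
    (hf : ∀ x, |f x| ≤ c) :
    ∫ ω in G, f (Z t ω) ∂μ = ∫ ω in G, ∑ x ∈ F (φ (Z t ω)), M (φ (Z t ω)) x * f x ∂μ := by
  have hX : Measurable fun ω => φ (Z t ω) := (Measurable.of_discrete (f := φ)).comp (hZ t)
  have i1 : Integrable (fun ω => f (Z t ω)) μ := integrable_comp_of_bounded hf (hZ t)
  have i2 : Integrable (fun ω => ∑ x ∈ F (φ (Z t ω)), M (φ (Z t ω)) x * f x) μ :=
    integrable_comp_of_bounded (f := fun z => ∑ x ∈ F z, M z x * f x)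
      (h.abs_sum_mul_le hf) hX
  set X : Ω → T := fun ω => φ (Z t ω) with hXdef
  have hU : G = ⋃ z, G ∩ X ⁻¹' {z} := by
    rw [← Set.inter_iUnion, ← Set.preimage_iUnion, Set.iUnion_of_singleton, Set.preimage_univ,
      Set.inter_univ]
  have hm : ∀ z, MeasurableSet (G ∩ X ⁻¹' {z}) := fun z => hG.inter (hX (.of_discrete))
  have hdisj : Pairwise (Function.onFun Disjoint fun z => G ∩ X ⁻¹' {z}) := by
    intro z z' hz
    refine Set.disjoint_left.2 fun ω h1 h2 => hz ?_
    exact h1.2.symm.trans h2.2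
  rw [hU, integral_iUnion hm hdisj i1.integrableOn, integral_iUnion hm hdisj i2.integrableOn]
  refine tsum_congr fun z => ?_
  have e1 : ∫ ω in G ∩ X ⁻¹' {z}, f (Z t ω) ∂μ
      = ∫ ω in G ∩ X ⁻¹' {z}, ∑ x ∈ F z, f x * (Z t ⁻¹' {x}).indicator 1 ω ∂μ := by
    refine setIntegral_congr_fun (hm z) fun ω hω => ?_
    have : Z t ω ∈ F z := (h.mem_fiber _ _).2 hω.2
    rw [Finset.sum_eq_single_of_mem _ this fun x _ hx => ?_]
    · simp
    · rw [Set.indicator_of_notMem, mul_zero]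
      exact fun hh => hx hh.symm
  have e2 : ∫ ω in G ∩ X ⁻¹' {z}, ∑ x ∈ F (X ω), M (X ω) x * f x ∂μ
      = ∫ ω in G ∩ X ⁻¹' {z}, ∑ x ∈ F z, M z x * f x ∂μ := by
    refine setIntegral_congr_fun (hm z) fun ω hω => ?_
    rw [show X ω = z from hω.2]
  rw [e1, e2, setIntegral_const, smul_eq_mul, Finset.mul_sum, integral_finsetSum]
  · refine Finset.sum_congr rfl fun x hx => ?_
    have hx' := (h.mem_fiber z x).1 hx
    rw [integral_const_mul, integral_indicator_one (hZ t .of_discrete), measureReal_restrict_apply (hZ t .of_discrete)]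
    have : Z t ⁻¹' {x} ∩ (G ∩ X ⁻¹' {z}) = G ∩ Z t ⁻¹' {x} := by
      ext ω
      simp only [Set.mem_inter_iff, Set.mem_preimage, Set.mem_singleton_iff]
      constructor
      · tauto
      · rintro ⟨h1, h2⟩
        exact ⟨h2, h1, by rw [hXdef]; simp only; rw [h2, hx']⟩
    have hc := hcond x
    rw [hx'] at hc
    rw [this, hc]
    ring
  · intro x _
    refine ((integrable_const (1 : ℝ)).indicator (hZ t .of_discrete)).integrableOn.const_mul _

/-- The law of the chain at time `s + t` on an event of its history at time `s`. -/
theorem measureReal_inter_preimage (hZ : ∀ t, Measurable (Z t)) {s t : ℝ≥0} {y : S}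
    (hmar : μ[(Z (s + t) ⁻¹' {y}).indicator (fun _ => (1 : ℝ)) | history Z s]
        =ᵐ[μ] fun ω => P t (Z s ω) y) {G : Set Ω} (hG : MeasurableSet[history Z s] G) :
    μ.real (G ∩ Z (s + t) ⁻¹' {y}) = ∫ ω in G, P t (Z s ω) y ∂μ := by
  rw [← setIntegral_indicator_one_eq (hZ _ .of_discrete),
    ← setIntegral_condExp (history_le hZ s)
      ((integrable_const (1 : ℝ)).indicator (hZ _ .of_discrete)) hG]
  exact integral_congr_ae (ae_restrict_of_ae hmar)

/-- Conditioning turns the Markov transition into the average `M P_t`, and the intertwining writes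
it as `P'_t M`. The factor `M (φ y) y` comes out of the integral: what is left is the law of the
image, and the factor itself is the new conditional law. -/
theorem IsConditionedAt.step (h : IsIntertwined φ F M Q Q') (hP : IsTransitionSemigroup Q P)
    (hZ : ∀ t, Measurable (Z t))
    (hmar : ∀ (s t : ℝ≥0) (y : S), μ[(Z (s + t) ⁻¹' {y}).indicator (fun _ => (1 : ℝ)) | history Z s]
        =ᵐ[μ] fun ω => P t (Z s ω) y)
    {s : ℝ≥0} {G : Set Ω} (hG : MeasurableSet[history Z s] G)
    (hcond : IsConditionedAt μ Z φ M s G) (t : ℝ≥0) :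
    (∀ z, μ.real (G ∩ (fun ω => φ (Z (s + t) ω)) ⁻¹' {z})
      = ∫ ω in G, imageSemigroup F M P t (φ (Z s ω)) z ∂μ) ∧
    IsConditionedAt μ Z φ M (s + t) G := by
  have hGm : MeasurableSet G := history_le hZ s _ hG
  have hX : ∀ t, Measurable fun ω => φ (Z t ω) := fun t =>
    (Measurable.of_discrete (f := φ)).comp (hZ t)
  have h1 : ∀ y, μ.real (G ∩ Z (s + t) ⁻¹' {y})
      = M (φ y) y * ∫ ω in G, imageSemigroup F M P t (φ (Z s ω)) (φ y) ∂μ := by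
    intro y
    rw [measureReal_inter_preimage hZ (hmar s t y) hG,
      hcond.setIntegral_eq h.toIsLink hZ hGm (f := fun x => P t x y) (c := 1), ← integral_const_mul]
    · refine setIntegral_congr_fun hGm fun ω _ => ?_
      rw [h.semigroup_intertwine hP t.coe_nonneg, mul_comm]
    · intro x
      rw [abs_of_nonneg (hP.nonneg t t.2 x y)]
      exact hP.le_one t.2 x y
  have h2 : ∀ z, μ.real (G ∩ (fun ω => φ (Z (s + t) ω)) ⁻¹' {z})
      = ∫ ω in G, imageSemigroup F M P t (φ (Z s ω)) z ∂μ := by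
    intro z
    have hU : G ∩ (fun ω => φ (Z (s + t) ω)) ⁻¹' {z} = ⋃ y ∈ F z, G ∩ Z (s + t) ⁻¹' {y} := by
      ext ω
      simp [h.mem_fiber]
    rw [hU, measureReal_biUnion_finset]
    · rw [← one_mul (∫ ω in G, _ ∂μ), ← h.sum_eq_one z, Finset.sum_mul]
      refine Finset.sum_congr rfl fun y hy => ?_
      rw [h1, (h.mem_fiber z y).1 hy]
    · intro y _ y' _ hyy
      refine Set.disjoint_left.2 fun ω h1 h2 => hyy ?_
      exact h1.2.symm.trans h2.2
    · exact fun y _ => hGm.inter (hZ _ .of_discrete)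
  exact ⟨h2, fun y => by rw [h1, h2]⟩

/-- Cylinder events are treated by induction on their largest time, alternating intersection and
propagation; the rest is uniqueness of finite measures on a π-system. -/
theorem isConditionedAt_of_measurableSet_history (h : IsIntertwined φ F M Q Q')
    (hP : IsTransitionSemigroup Q P) (hZ : ∀ t, Measurable (Z t))
    (hmar : ∀ (s t : ℝ≥0) (y : S), μ[(Z (s + t) ⁻¹' {y}).indicator (fun _ => (1 : ℝ)) | history Z s]
        =ᵐ[μ] fun ω => P t (Z s ω) y)
    (h0 : IsConditionedAt μ Z φ M 0 Set.univ) (t : ℝ≥0) {G : Set Ω}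
    (hG : MeasurableSet[history (fun s ω => φ (Z s ω)) t] G) : IsConditionedAt μ Z φ M t G := by
  classical
  have hX : ∀ t, Measurable fun ω => φ (Z t ω) := fun t =>
    (Measurable.of_discrete (f := φ)).comp (hZ t)
  have cyl : ∀ (I : Finset ℝ≥0) (B : ℝ≥0 → Set T) (t : ℝ≥0), (∀ s ∈ I, s ≤ t) →
      IsConditionedAt μ Z φ M t (⋂ s ∈ I, (fun ω => φ (Z s ω)) ⁻¹' B s) := by
    intro I B
    induction I using Finset.induction_on_max with
    | empty =>
      intro t _
      have := (h0.step h hP hZ hmar MeasurableSet.univ t).2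
      simpa using this
    | insert m I hI ih =>
      intro t ht
      have hm := ht m (Finset.mem_insert_self _ _)
      -- The time `m` exceeds all the others: the earlier cylinder is carried to time `m`, cut down
      -- there, and only then carried on to time `t`.
      have h1 := (ih m fun s hs => (hI s hs).le).inter_preimage (B m)
      have h2 : MeasurableSet[history Z m]
          ((⋂ s ∈ I, (fun ω => φ (Z s ω)) ⁻¹' B s) ∩ (fun ω => φ (Z m ω)) ⁻¹' B m) := by
        refine history_comp_le Z (.of_discrete (f := φ)) m _ ?_
        refine MeasurableSet.inter (Finset.measurableSet_biInter _ fun s hs => ?_) ?_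
        · exact measurable_history (fun s ω => φ (Z s ω)) (hI s hs).le .of_discrete
        · exact measurable_history (fun s ω => φ (Z s ω)) le_rfl .of_discrete
      have h3 := (h1.step h hP hZ hmar h2 (t - m)).2
      rw [add_tsub_cancel_of_le hm] at h3
      rw [Finset.set_biInter_insert, Set.inter_comm]
      exact h3
  intro y
  have hle := history_le hX t
  have hMy : 0 ≤ M (φ y) y := h.nonneg _ _
  -- Restates the identity for `G` as agreement of two finite measures on the history, so that
  -- cylinders and the total mass suffice.
  have key : ∀ G, MeasurableSet[history (fun s ω => φ (Z s ω)) t] G →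
      μ.real (G ∩ Z t ⁻¹' {y}) = M (φ y) y * μ.real (G ∩ (fun ω => φ (Z t ω)) ⁻¹' {φ y}) →
      (μ.restrict (Z t ⁻¹' {y})).trim hle G = (ENNReal.ofReal (M (φ y) y) •
        (μ.restrict ((fun ω => φ (Z t ω)) ⁻¹' {φ y})).trim hle) G := by
    intro G hG hreal
    rw [trim_measurableSet_eq hle hG, Measure.smul_apply, trim_measurableSet_eq hle hG,
      Measure.restrict_apply (hle _ hG), Measure.restrict_apply (hle _ hG), smul_eq_mul,
      ← ENNReal.ofReal_toReal (measure_ne_top μ (G ∩ (fun ω => φ (Z t ω)) ⁻¹' {φ y})),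
      ← ENNReal.ofReal_mul hMy]
    change _ = ENNReal.ofReal (M (φ y) y * μ.real (G ∩ (fun ω => φ (Z t ω)) ⁻¹' {φ y}))
    rw [← hreal]
    exact (ENNReal.ofReal_toReal (measure_ne_top μ _)).symm
  have hcyl : ∀ I : Finset ℝ≥0, (I : Set ℝ≥0) ⊆ Set.Iic t → ∀ f : ℝ≥0 → Set Ω,
      (∀ s ∈ I, MeasurableSet[MeasurableSpace.comap (fun ω => φ (Z s ω)) inferInstance] (f s)) →
      IsConditionedAt μ Z φ M t (⋂ s ∈ I, f s) := by
    intro I hI f hf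
    choose! B hB using hf
    have : ⋂ s ∈ I, f s = ⋂ s ∈ I, (fun ω => φ (Z s ω)) ⁻¹' B s :=
      Set.iInter₂_congr fun s hs => (hB s hs).2.symm
    rw [this]
    exact cyl I B t fun s hs => hI hs
  have huniv : IsConditionedAt μ Z φ M t Set.univ := by
    simpa using hcyl ∅ (by simp) (fun _ => ∅) (by simp)
  have hfin : IsFiniteMeasure ((μ.restrict (Z t ⁻¹' {y})).trim hle) := inferInstance
  have := ext_of_generate_finite _ (history_eq_generateFrom (fun s ω => φ (Z s ω)) t)
    (isPiSystem_piiUnionInter _ (fun s => @MeasurableSpace.isPiSystem_measurableSet _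
      (MeasurableSpace.comap (fun ω => φ (Z s ω)) inferInstance)) _)
    (μ := (μ.restrict (Z t ⁻¹' {y})).trim hle)
    (ν := ENNReal.ofReal (M (φ y) y) •
        (μ.restrict ((fun ω => φ (Z t ω)) ⁻¹' {φ y})).trim hle)
    (fun A hA => by
      have hA' : MeasurableSet[history (fun s ω => φ (Z s ω)) t] A := by
        rw [history_eq_generateFrom]; exact MeasurableSpace.measurableSet_generateFrom hA
      obtain ⟨I, hI, f, hf, rfl⟩ := hA
      exact key _ hA' (hcyl I hI f hf y))
    (key _ MeasurableSet.univ (huniv y))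
  have h4 := congrArg (fun ν => (ν G).toReal) this
  simp only [Measure.smul_apply, trim_measurableSet_eq hle hG] at h4
  rw [Measure.restrict_apply (hle _ hG), Measure.restrict_apply (hle _ hG), smul_eq_mul,
    ENNReal.toReal_mul, ENNReal.toReal_ofReal hMy] at h4
  exact h4

/-- **Markov functions.** If the rates of a Markov chain `Z` are intertwined with the rate matrix `Q'`
by a link `M`, and `Z` starts from `M z₀`, then `φ(Z)` is a Markov chain with rates `Q'`, and the
conditional law of `Z t` given the history of `φ(Z)` is `M (φ (Z t))`. -/
theorem IsMarkovChain.image (h : IsIntertwined φ F M Q Q') (hZ : IsMarkovChain μ Z Q) (z₀ : T)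
    (hinit : ∀ y, μ.real (Z 0 ⁻¹' {y}) = M z₀ y) :
    IsMarkovChain μ (fun t ω => φ (Z t ω)) Q' ∧ (∀ᵐ ω ∂μ, φ (Z 0 ω) = z₀) ∧
    ∀ (t : ℝ≥0) (A : Set S),
      μ[(Z t ⁻¹' A).indicator (fun _ => (1 : ℝ)) | history (fun s ω => φ (Z s ω)) t]
        =ᵐ[μ] fun ω => ∑ x ∈ F (φ (Z t ω)), M (φ (Z t ω)) x * A.indicator (fun _ => 1) x := by
  obtain ⟨P, hP, hmar⟩ := hZ.markov
  have hX : ∀ t, Measurable fun ω => φ (Z t ω) := fun t =>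
    (Measurable.of_discrete (f := φ)).comp (hZ.measurable t)
  have hstart : μ.real ((fun ω => φ (Z 0 ω)) ⁻¹' {z₀}) = 1 := by
    have hU : (fun ω => φ (Z 0 ω)) ⁻¹' {z₀} = ⋃ y ∈ F z₀, Z 0 ⁻¹' {y} := by
      ext ω
      simp [h.mem_fiber]
    rw [hU, measureReal_biUnion_finset, ← h.sum_eq_one z₀]
    · exact Finset.sum_congr rfl fun y _ => hinit y
    · intro y _ y' _ hyy
      refine Set.disjoint_left.2 fun ω h1 h2 => hyy ?_
      exact h1.symm.trans h2
    · exact fun y _ => hZ.measurable _ .of_discrete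
  have hae : ∀ᵐ ω ∂μ, φ (Z 0 ω) = z₀ := by
    have h1 : μ ((fun ω => φ (Z 0 ω)) ⁻¹' {z₀}) = 1 := by
      rw [← ENNReal.ofReal_toReal (measure_ne_top μ _)]
      change ENNReal.ofReal (μ.real _) = 1
      rw [hstart, ENNReal.ofReal_one]
    exact (prob_compl_eq_zero_iff (hX 0 .of_discrete)).2 h1
  -- The initial law is the base case; off the fibre of `z₀` both sides vanish.
  have h0 : IsConditionedAt μ Z φ M 0 Set.univ := by
    intro y
    simp only [Set.univ_inter]
    rw [hinit]
    by_cases hy : φ y = z₀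
    · rw [hy, hstart, mul_one]
    · have : μ ((fun ω => φ (Z 0 ω)) ⁻¹' {φ y}) = 0 :=
        measure_mono_null (fun ω hω hh => hy (hω.symm.trans hh)) hae
      rw [h.zero_of_ne z₀ y hy, measureReal_def, this, ENNReal.toReal_zero, mul_zero]
  have hcond := fun t G hG => isConditionedAt_of_measurableSet_history (G := G) h hP hZ.measurable
    hmar h0 t hG
  refine ⟨⟨hX, ?_, ?_, imageSemigroup F M P, h.isTransitionSemigroup hP, ?_⟩, hae, ?_⟩
  · filter_upwards [hZ.right_cont] with ω hω t
    filter_upwards [hω t] with s hs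
    rw [hs]
  · filter_upwards [hZ.left_lim] with ω hω t
    obtain ⟨x, hx⟩ := hω t
    refine ⟨φ x, ?_⟩
    filter_upwards [hx] with s hs
    rw [hs]
  · intro s t z
    have hb : ∀ z', |imageSemigroup F M P t z' z| ≤ 1 := fun z' =>
      h.abs_sum_mul_le (f := fun x => ∑ y ∈ F z, P t x y) (fun x => by
        rw [abs_of_nonneg (Finset.sum_nonneg fun y _ => hP.nonneg t t.2 x y)]
        exact hP.sum_le_one t.2 x _) z'
    symm
    refine ae_eq_condExp_of_forall_setIntegral_eq (history_le hX s)
      ((integrable_const (1 : ℝ)).indicator (hX _ .of_discrete))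
      (fun G _ _ => (integrable_comp_of_bounded (f := fun z' => imageSemigroup F M P t z' z) hb
        (hX s)).integrableOn) (fun G hG _ => ?_) ?_
    · rw [setIntegral_indicator_one_eq (hX _ .of_discrete)]
      exact (((hcond s G hG).step h hP hZ.measurable hmar
        (history_comp_le Z (.of_discrete (f := φ)) s _ hG) t).1 z).symm
    · exact ((Measurable.of_discrete (f := fun z' => imageSemigroup F M P t z' z)).comp
        (measurable_history (fun s ω => φ (Z s ω)) le_rfl)).aestronglyMeasurable
  · intro t A
    have hA : ∀ x, |A.indicator (fun _ => (1 : ℝ)) x| ≤ 1 := fun x => by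
      by_cases hx : x ∈ A <;> simp [hx]
    symm
    refine ae_eq_condExp_of_forall_setIntegral_eq (history_le hX t)
      ((integrable_const (1 : ℝ)).indicator (hZ.measurable _ .of_discrete))
      (fun G _ _ => (integrable_comp_of_bounded
        (f := fun z => ∑ x ∈ F z, M z x * A.indicator (fun _ => 1) x) (h.abs_sum_mul_le hA)
        (hX t)).integrableOn) (fun G hG _ => ?_) ?_
    · exact ((hcond t G hG).setIntegral_eq h.toIsLink hZ.measurable (history_le hX t _ hG) hA).symm
    · exact ((Measurable.of_discrete
        (f := fun z => ∑ x ∈ F z, M z x * A.indicator (fun _ => (1 : ℝ)) x)).comp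
        (measurable_history (fun s ω => φ (Z s ω)) le_rfl)).aestronglyMeasurable

end

/-! ### `q`-binomial coefficients with integer arguments -/

section qBinom

variable {q : ℝ}

theorem one_sub_zpow_pos (hq0 : 0 < q) (hq1 : q < 1) {k : ℤ} (hk : 0 < k) : 0 < 1 - q ^ k :=
  sub_pos.2 (zpow_lt_one₀ hq0 hq1 hk)

theorem one_sub_zpow_nonneg (hq0 : 0 < q) (hq1 : q < 1) {k : ℤ} (hk : 0 ≤ k) : 0 ≤ 1 - q ^ k :=
  sub_nonneg.2 (zpow_le_one₀ hq0 hq1.le hk)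

theorem one_sub_zpow_ne_zero (hq0 : 0 < q) (hq1 : q < 1) {k : ℤ} (hk : 0 < k) : 1 - q ^ k ≠ 0 :=
  (one_sub_zpow_pos hq0 hq1 hk).ne'

theorem qFactorial_pos (hq0 : 0 < q) (hq1 : q < 1) (m : ℕ) : 0 < qFactorial q m :=
  Finset.prod_pos fun k hk => div_pos
    (sub_pos.2 (pow_lt_one₀ hq0.le hq1 (by have := (Finset.mem_Icc.1 hk).1; omega)))
    (sub_pos.2 hq1)

theorem qFactorial_succ (q : ℝ) (m : ℕ) :
    qFactorial q (m + 1) = qFactorial q m * ((1 - q ^ (m + 1)) / (1 - q)) :=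
  Finset.prod_Icc_succ_top (by omega) _

theorem qBinom_pos (hq0 : 0 < q) (hq1 : q < 1) {m k : ℤ} (h0 : 0 ≤ k) (h1 : k ≤ m) :
    0 < qBinom q m k := by
  rw [qBinom, if_pos ⟨h0, h1⟩]
  exact div_pos (qFactorial_pos hq0 hq1 _)
    (mul_pos (qFactorial_pos hq0 hq1 _) (qFactorial_pos hq0 hq1 _))

theorem qBinom_eq_zero {m k : ℤ} (h : ¬ (0 ≤ k ∧ k ≤ m)) : qBinom q m k = 0 := if_neg h

theorem qBinom_self (hq0 : 0 < q) (hq1 : q < 1) {m : ℤ} (hm : 0 ≤ m) : qBinom q m m = 1 := by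
  rw [qBinom, if_pos ⟨hm, le_rfl⟩, sub_self]
  have h0 : qFactorial q (Int.toNat 0) = 1 := by simp [qFactorial]
  rw [h0, mul_one, div_self (qFactorial_pos hq0 hq1 _).ne']

theorem qBinom_symm (m k : ℤ) : qBinom q m (m - k) = qBinom q m k := by
  by_cases h : 0 ≤ k ∧ k ≤ m
  · rw [qBinom, qBinom, if_pos h, if_pos (by omega), sub_sub_cancel, mul_comm (qFactorial q _)]
  · rw [qBinom_eq_zero h, qBinom_eq_zero (by omega)]

/-- Absorption. It needs no range condition: at `k = 0`, where the left coefficient leaves its range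
first, the factor `1 - q ^ k` vanishes. -/
theorem qBinom_pred_pred (hq0 : 0 < q) (hq1 : q < 1) (m k : ℤ) :
    (1 - q ^ m) * qBinom q (m - 1) (k - 1) = (1 - q ^ k) * qBinom q m k := by
  rcases lt_trichotomy k 0 with hk | rfl | hk
  · rw [qBinom_eq_zero (by omega), qBinom_eq_zero (by omega), mul_zero, mul_zero]
  · rw [qBinom_eq_zero (by omega), zpow_zero, sub_self, zero_mul, mul_zero]
  by_cases hm : k ≤ m
  · obtain ⟨a, rfl⟩ : ∃ a : ℕ, k = a + 1 := ⟨(k - 1).toNat, by omega⟩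
    obtain ⟨b, rfl⟩ : ∃ b : ℕ, m = a + b + 1 := ⟨(m - (a + 1)).toNat, by omega⟩
    rw [qBinom, qBinom, if_pos (by omega), if_pos (by omega),
      show ((a : ℤ) + b + 1 - 1).toNat = a + b by omega,
      show ((a : ℤ) + 1 - 1).toNat = a by omega,
      show ((a : ℤ) + b + 1 - 1 - (a + 1 - 1)).toNat = b by omega,
      show ((a : ℤ) + b + 1).toNat = a + b + 1 by omega,
      show ((a : ℤ) + 1).toNat = a + 1 by omega,
      show ((a : ℤ) + b + 1 - (a + 1)).toNat = b by omega, qFactorial_succ, qFactorial_succ]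
    have h1 := (qFactorial_pos hq0 hq1 a).ne'
    have h2 := (qFactorial_pos hq0 hq1 b).ne'
    have h3 : 1 - q ^ ((a : ℤ) + 1) ≠ 0 := one_sub_zpow_ne_zero hq0 hq1 (by omega)
    have h4 : 1 - q ≠ 0 := (sub_pos.2 hq1).ne'
    have e1 : q ^ ((a : ℤ) + 1) = q ^ (a + 1) := by exact_mod_cast zpow_natCast q (a + 1)
    have e2 : q ^ ((a : ℤ) + b + 1) = q ^ (a + b + 1) := by
      exact_mod_cast zpow_natCast q (a + b + 1)
    rw [e1] at h3
    rw [e1, e2]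
    field_simp
  · rw [qBinom_eq_zero (by omega), qBinom_eq_zero (by omega), mul_zero, mul_zero]

theorem qBinom_pred (hq0 : 0 < q) (hq1 : q < 1) (m k : ℤ) :
    (1 - q ^ m) * qBinom q (m - 1) k = (1 - q ^ (m - k)) * qBinom q m k := by
  rw [← qBinom_symm (m - 1), ← qBinom_symm m k, ← qBinom_pred_pred hq0 hq1, sub_right_comm]

theorem qBinom_succ_right (hq0 : 0 < q) (hq1 : q < 1) (m k : ℤ) :
    (1 - q ^ (k + 1)) * qBinom q m (k + 1) = (1 - q ^ (m - k)) * qBinom q m k := by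
  rw [← qBinom_pred_pred hq0 hq1, ← qBinom_pred hq0 hq1, add_sub_cancel_right]

/-- A q-Pascal rule, obtained from two absorptions after multiplication by `1 - q ^ (m + 1)`, which
`hm` makes nonzero. The bound matters: the rule fails at `m = k = -1`. -/
theorem qBinom_succ_succ (hq0 : 0 < q) (hq1 : q < 1) {m : ℤ} (hm : 0 ≤ m) (k : ℤ) :
    qBinom q (m + 1) (k + 1) = qBinom q m k + q ^ (k + 1) * qBinom q m (k + 1) := by
  have h1 := qBinom_pred_pred hq0 hq1 (m + 1) (k + 1)
  have h2 := qBinom_pred hq0 hq1 (m + 1) (k + 1)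
  rw [add_sub_cancel_right] at h1 h2
  rw [add_sub_cancel_right] at h1
  refine mul_left_cancel₀ (one_sub_zpow_ne_zero hq0 hq1 (k := m + 1) (by omega)) ?_
  have e : q ^ (m + 1) = q ^ (k + 1) * q ^ (m + 1 - (k + 1)) := by
    rw [← zpow_add₀ hq0.ne']; congr 1; ring
  rw [mul_add, h1, mul_left_comm, h2, e]
  ring

theorem qBinom_succ_succ' (hq0 : 0 < q) (hq1 : q < 1) {m : ℤ} (hm : 0 ≤ m) (k : ℤ) :
    qBinom q (m + 1) k = qBinom q m k + q ^ (m + 1 - k) * qBinom q m (k - 1) := by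
  have h1 := qBinom_pred_pred hq0 hq1 (m + 1) k
  have h2 := qBinom_pred hq0 hq1 (m + 1) k
  rw [add_sub_cancel_right] at h1 h2
  refine mul_left_cancel₀ (one_sub_zpow_ne_zero hq0 hq1 (k := m + 1) (by omega)) ?_
  have e : q ^ (m + 1) = q ^ (m + 1 - k) * q ^ k := by
    rw [← zpow_add₀ hq0.ne']; congr 1; ring
  rw [mul_add, h2, mul_left_comm, h1, e]
  ring

end qBinom

/-! ### Weights of two consecutive rows -/

/-- The weight of the rows `x`, `y`, with at most `m` entries and parameter `b`. -/
noncomputable def rowWeight (q b : ℝ) (m : ℕ) (x y : ℕ → ℤ) : ℝ :=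
  b ^ (∑ i ∈ Finset.Icc 1 m, y i - ∑ i ∈ Finset.Icc 1 m, x i)
    * ∏ i ∈ Finset.Icc 1 m, qBinom q (y i - y (i + 1)) (y i - x i)

/-- The rate at which the `i`-th entry of a row is increased. -/
noncomputable def upRate (q : ℝ) (i : ℕ) (x : ℕ → ℤ) : ℝ :=
  if i = 1 then 1 else 1 - q ^ (x (i - 1) - x i)

/-- The rate at which the `i`-th entry of a row is decreased. -/
noncomputable def downRate (q : ℝ) (i : ℕ) (x : ℕ → ℤ) : ℝ :=
  1 - q ^ (x i - x (i + 1))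

/-- Add `c` to the `i`-th entry of a row. -/
def bump (x : ℕ → ℤ) (i : ℕ) (c : ℤ) : ℕ → ℤ := x + Pi.single i c

theorem bump_self (x : ℕ → ℤ) (i : ℕ) (c : ℤ) : bump x i c i = x i + c := by simp [bump]

theorem bump_of_ne (x : ℕ → ℤ) {i j : ℕ} (h : j ≠ i) (c : ℤ) : bump x i c j = x j := by
  simp [bump, h]

theorem sum_bump (x : ℕ → ℤ) {i : ℕ} {s : Finset ℕ} (h : i ∈ s) (c : ℤ) :
    ∑ j ∈ s, bump x i c j = ∑ j ∈ s, x j + c := by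
  simp [bump, Finset.sum_add_distrib, Finset.sum_pi_single', h]

section rowWeight

variable {q b : ℝ} {m : ℕ} {x y t : ℕ → ℤ}

/-- The part of the row weight that does not involve the entries with index in `s`. -/
noncomputable def restWeight (q b : ℝ) (s : Finset ℕ) (m : ℕ) (x y : ℕ → ℤ) : ℝ :=
  b ^ (∑ i ∈ Finset.Icc 1 m, y i - ∑ i ∈ Finset.Icc 1 m, x i)
    * ∏ i ∈ Finset.Icc 1 m \ s, qBinom q (y i - y (i + 1)) (y i - x i)

theorem rowWeight_eq {i : ℕ} (hi : i ∈ Finset.Icc 1 m) :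
    rowWeight q b m x y = restWeight q b {i} m x y * qBinom q (y i - y (i + 1)) (y i - x i) := by
  rw [rowWeight, restWeight, Finset.sdiff_singleton_eq_erase, mul_assoc, Finset.prod_erase_mul _ _ hi]

theorem rowWeight_bump (hb : b ≠ 0) {i : ℕ} (hi : i ∈ Finset.Icc 1 m) (c : ℤ) :
    rowWeight q b m (bump x i c) y
      = b ^ (-c) * restWeight q b {i} m x y
        * qBinom q (y i - y (i + 1)) (y i - (x i + c)) := by
  rw [rowWeight_eq hi, bump_self, restWeight, restWeight, sum_bump x hi,
    show ∀ A B : ℤ, A - (B + c) = -c + (A - B) by intros; ring, zpow_add₀ hb, mul_assoc (b ^ (-c))]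
  congr 3
  refine Finset.prod_congr rfl fun j hj => ?_
  rw [bump_of_ne]
  rintro rfl
  simp at hj

/-- The entry `y 1` occurs in one q-binomial only, because no entry precedes it. -/
theorem rowWeight_bump_one (hb : b ≠ 0) (hm : 1 ≤ m) (c : ℤ) :
    rowWeight q b m x (bump y 1 c)
      = b ^ c * restWeight q b {1} m x y
        * qBinom q (y 1 + c - y 2) (y 1 + c - x 1) := by
  have hi : 1 ∈ Finset.Icc 1 m := Finset.mem_Icc.2 ⟨le_rfl, hm⟩
  rw [rowWeight_eq hi, bump_self, bump_of_ne y (by omega : 1 + 1 ≠ 1), restWeight,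
    restWeight, sum_bump y hi,
    show ∀ A B : ℤ, A + c - B = c + (A - B) by intros; ring, zpow_add₀ hb, mul_assoc (b ^ c)]
  congr 3
  refine Finset.prod_congr rfl fun j hj => ?_
  have : 1 < j := by
    simp only [Finset.mem_sdiff, Finset.mem_Icc, Finset.mem_singleton] at hj; omega
  rw [bump_of_ne, bump_of_ne] <;> omega

theorem restWeight_singleton {i j : ℕ} (hi : i ∈ Finset.Icc 1 m) (hij : i ≠ j) :
    restWeight q b {j} m x y
      = restWeight q b {i, j} m x y * qBinom q (y i - y (i + 1)) (y i - x i) := by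
  rw [restWeight, restWeight, mul_assoc]
  congr 1
  rw [← Finset.prod_erase_mul (Finset.Icc 1 m \ {j}) _ (a := i) (by simp_all)]
  congr 2
  ext k
  simp only [Finset.mem_erase, Finset.mem_sdiff, Finset.mem_Icc, Finset.mem_singleton,
    Finset.mem_insert]
  tauto

/-- The entry `y (i + 1)` occurs in the factors with indices `i` and `i + 1`, so both are split off.
-/
theorem rowWeight_bump_succ (hb : b ≠ 0) {i : ℕ} (hi : 1 ≤ i) (him : i + 1 ≤ m) (c : ℤ) :
    rowWeight q b m x (bump y (i + 1) c)
      = b ^ c * restWeight q b {i, i + 1} m x y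
        * qBinom q (y i - (y (i + 1) + c)) (y i - x i)
        * qBinom q (y (i + 1) + c - y (i + 2)) (y (i + 1) + c - x (i + 1)) := by
  have hi1 : i ∈ Finset.Icc 1 m := Finset.mem_Icc.2 ⟨hi, by omega⟩
  have hi2 : i + 1 ∈ Finset.Icc 1 m := Finset.mem_Icc.2 ⟨by omega, him⟩
  rw [rowWeight_eq hi2, restWeight_singleton hi1 (by omega), bump_self,
    bump_of_ne y (by omega : i + 1 + 1 ≠ i + 1), bump_of_ne y (by omega : i ≠ i + 1),
    restWeight, restWeight, sum_bump y hi2]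
  congr 2
  rw [show ∀ A B : ℤ, A + c - B = c + (A - B) by intros; ring, zpow_add₀ hb, mul_assoc (b ^ c)]
  congr 2
  refine Finset.prod_congr rfl fun j hj => ?_
  have : j ≠ i ∧ j ≠ i + 1 := by
    simp only [Finset.mem_sdiff, Finset.mem_insert, Finset.mem_singleton] at hj; omega
  rw [bump_of_ne, bump_of_ne] <;> omega

/-! ### The one-step identities -/

theorem upRate_mul_pushProb_one (y : ℕ → ℤ) :
    upRate q 1 (bump t 1 (-1)) * pushProb q 1 y (bump t 1 (-1)) = q ^ (y 1 - t 1 + 1) := by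
  rw [upRate, pushProb, if_pos rfl, if_pos rfl, bump_self, one_mul]
  congr 1; ring

/-- The source is the target row `t` with one unit removed; there the up-rate is exactly the
denominator of the push probability, and it cancels. -/
theorem upRate_mul_pushProb_succ (hq0 : 0 < q) (hq1 : q < 1) {i : ℕ} (hi : 1 ≤ i)
    (ht : t (i + 1) ≤ t i) (y : ℕ → ℤ) :
    upRate q (i + 1) (bump t (i + 1) (-1)) * pushProb q (i + 1) y (bump t (i + 1) (-1))
      = q ^ (y (i + 1) - t (i + 1) + 1) * (1 - q ^ (t i - y (i + 1))) := by
  have h : 1 - q ^ (t i - (t (i + 1) + -1)) ≠ 0 := one_sub_zpow_ne_zero hq0 hq1 (by omega)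
  rw [upRate, pushProb, if_neg (by omega), if_neg (by omega), Nat.add_sub_cancel, bump_self,
    bump_of_ne t (by omega : i ≠ i + 1),
    show y (i + 1) - t (i + 1) + 1 = y (i + 1) - (t (i + 1) + -1) by ring]
  field_simp

/-- After the same cancellation the dependence on `x (i - 1)` disappears. The hypothesis excludes a
vanishing denominator. -/
theorem upRate_mul_one_sub_pushProb (hq0 : 0 < q) (hq1 : q < 1) {i : ℕ}
    (hx : i ≠ 1 → x i < x (i - 1)) (y : ℕ → ℤ) :
    upRate q i x * (1 - pushProb q i y x) = 1 - q ^ (y i - x i) := by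
  rw [upRate, pushProb]
  split_ifs with h
  · rw [h, one_mul]
  · have h1 : 1 - q ^ (x (i - 1) - x i) ≠ 0 :=
      one_sub_zpow_ne_zero hq0 hq1 (by have := hx h; omega)
    have h2 : q ^ (x (i - 1) - x i) = q ^ (x (i - 1) - y i) * q ^ (y i - x i) := by
      rw [← zpow_add₀ hq0.ne']; congr 1; ring
    rw [mul_sub, mul_one, mul_left_comm, mul_div_cancel₀ _ h1, h2]
    ring

theorem downRate_mul_pullProb (hq0 : 0 < q) (hq1 : q < 1) {i : ℕ}
    (ht : t (i + 1) ≤ t i) (y : ℕ → ℤ) :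
    downRate q i (bump t i 1) * pullProb q i y (bump t i 1)
      = q ^ (t i + 1 - y (i + 1)) * (1 - q ^ (y (i + 1) - t (i + 1))) := by
  have h : 1 - q ^ (t i + 1 - t (i + 1)) ≠ 0 := one_sub_zpow_ne_zero hq0 hq1 (by omega)
  rw [downRate, pullProb, bump_self, bump_of_ne t (by omega : i + 1 ≠ i)]
  field_simp

theorem downRate_mul_one_sub_pullProb (hq0 : 0 < q) (hq1 : q < 1) {i : ℕ}
    (ht : t (i + 1) ≤ t i) (y : ℕ → ℤ) :
    downRate q i (bump t i 1) * (1 - pullProb q i y (bump t i 1))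
      = 1 - q ^ (t i + 1 - y (i + 1)) := by
  have h2 : q ^ (t i + 1 - t (i + 1)) = q ^ (t i + 1 - y (i + 1)) * q ^ (y (i + 1) - t (i + 1)) := by
    rw [← zpow_add₀ hq0.ne']; congr 1; ring
  rw [mul_sub, mul_one, downRate_mul_pullProb hq0 hq1 ht, downRate, bump_self,
    bump_of_ne t (by omega : i + 1 ≠ i), h2]
  ring

/-- Creation of a right jump of the first entry. -/
theorem rowWeight_right_one (hq0 : 0 < q) (hq1 : q < 1) (hb : b ≠ 0) (hm : 1 ≤ m)
    (hy : y 2 ≤ y 1) :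
    upRate q 1 (bump t 1 (-1)) * rowWeight q b m (bump t 1 (-1)) y
        * pushProb q 1 y (bump t 1 (-1)) + b * rowWeight q b m t y
      = upRate q 1 y * rowWeight q b m t (bump y 1 1) := by
  have hi : 1 ∈ Finset.Icc 1 m := Finset.mem_Icc.2 ⟨le_rfl, hm⟩
  rw [mul_right_comm, upRate_mul_pushProb_one, rowWeight_bump hb hi, rowWeight_bump_one hb hm,
    rowWeight_eq hi, upRate, if_pos rfl, neg_neg, zpow_one]
  -- The two Pascal terms are the two origins of the jump: the clock of the entry itself and a push
  -- from the row above.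
  have h := qBinom_succ_succ hq0 hq1 (m := y 1 - y 2) (by omega) (y 1 - t 1)
  rw [show y 1 + 1 - y 2 = y 1 - y 2 + 1 by ring, show y 1 + 1 - t 1 = y 1 - t 1 + 1 by ring, h,
    show y 1 - (t 1 + -1) = y 1 - t 1 + 1 by ring]
  ring

/-- Propagation of right jumps. -/
theorem rowWeight_right_succ (hq0 : 0 < q) (hq1 : q < 1) (hb : b ≠ 0) {i : ℕ} (hi : 1 ≤ i)
    (him : i + 1 ≤ m) (ht : ∀ j, 1 ≤ j → t (j + 1) ≤ t j) (hy : y (i + 2) ≤ y (i + 1)) :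
    upRate q (i + 1) (bump t (i + 1) (-1)) * rowWeight q b m (bump t (i + 1) (-1)) y
        * pushProb q (i + 1) y (bump t (i + 1) (-1))
      + upRate q i (bump t i (-1)) * rowWeight q b m (bump t i (-1)) y
        * (1 - pushProb q i y (bump t i (-1)))
      = upRate q (i + 1) y * rowWeight q b m t (bump y (i + 1) 1) := by
  have hi1 : i ∈ Finset.Icc 1 m := Finset.mem_Icc.2 ⟨hi, by omega⟩
  have hi2 : i + 1 ∈ Finset.Icc 1 m := Finset.mem_Icc.2 ⟨by omega, him⟩
  rw [mul_right_comm, upRate_mul_pushProb_succ hq0 hq1 hi (ht i hi), mul_right_comm (upRate q i _),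
    upRate_mul_one_sub_pushProb hq0 hq1, rowWeight_bump hb hi1, rowWeight_bump hb hi2,
    rowWeight_bump_succ hb hi him, restWeight_singleton hi1 (by omega),
    restWeight_singleton hi2 (by omega), Finset.pair_comm (i + 1) i, upRate, if_neg (by omega),
    Nat.add_sub_cancel, neg_neg, zpow_one, bump_self]
  -- Pascal splits the factor with index `i + 1` between the two sources; absorption in the factor
  -- with index `i` accounts for the remaining powers of `q`.
  · have h1 := qBinom_succ_succ hq0 hq1 (m := y (i + 1) - y (i + 2)) (by omega) (y (i + 1) - t (i + 1))
    have h2 := qBinom_succ_right hq0 hq1 (y i - y (i + 1)) (y i - t i)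
    have h3 := qBinom_pred hq0 hq1 (y i - y (i + 1)) (y i - t i)
    rw [show y i - y (i + 1) - (y i - t i) = t i - y (i + 1) by ring] at h2 h3
    rw [show y (i + 1) + 1 - y (i + 2) = y (i + 1) - y (i + 2) + 1 by ring,
      show y (i + 1) + 1 - t (i + 1) = y (i + 1) - t (i + 1) + 1 by ring,
      show y (i + 1) - (t (i + 1) + -1) = y (i + 1) - t (i + 1) + 1 by ring,
      show y i - (t i + -1) = y i - t i + 1 by ring,
      show y i - (y (i + 1) + 1) = y i - y (i + 1) - 1 by ring, h1]
    linear_combination b * restWeight q b {i, i + 1} m t y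
      * (qBinom q (y (i + 1) - y (i + 1 + 1)) (y (i + 1) - t (i + 1)) * h2
        - (qBinom q (y (i + 1) - y (i + 2)) (y (i + 1) - t (i + 1)) + q ^ (y (i + 1) - t (i + 1) + 1)
          * qBinom q (y (i + 1) - y (i + 2)) (y (i + 1) - t (i + 1) + 1)) * h3)
  -- Lowering entry `i` puts it strictly below its left neighbour, so the push probability has a
  -- nonzero denominator.
  · intro h
    obtain ⟨k, rfl⟩ : ∃ k, i = k + 1 := ⟨i - 1, by omega⟩
    rw [bump_self, Nat.add_sub_cancel, bump_of_ne t (by omega : k ≠ k + 1)]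
    have := ht k (by omega)
    omega

/-- A left jump that is passed to the entry with the same index. -/
theorem rowWeight_left_same (hq0 : 0 < q) (hq1 : q < 1) (hb : b ≠ 0) {i : ℕ} (hi : i ∈ Finset.Icc 1 m)
    (ht : t (i + 1) ≤ t i) :
    downRate q i (bump t i 1) * rowWeight q b m (bump t i 1) y * (1 - pullProb q i y (bump t i 1))
      = b⁻¹ * (1 - q ^ (y i - t i)) * rowWeight q b m t y := by
  rw [mul_right_comm, downRate_mul_one_sub_pullProb hq0 hq1 ht, rowWeight_bump hb hi,
    rowWeight_eq hi, zpow_neg_one]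
  have h := qBinom_succ_right hq0 hq1 (y i - y (i + 1)) (y i - t i - 1)
  rw [sub_add_cancel, show y i - y (i + 1) - (y i - t i - 1) = t i + 1 - y (i + 1) by ring] at h
  rw [← sub_sub (y i)]
  linear_combination -(b⁻¹ * restWeight q b {i} m t y) * h

/-- No entry precedes the first one, so it receives left jumps from its own index only and
absorption alone suffices. -/
theorem rowWeight_left_one (hq0 : 0 < q) (hq1 : q < 1) (hb : b ≠ 0) (hm : 1 ≤ m) :
    b⁻¹ * (1 - q ^ (y 1 - t 1)) * rowWeight q b m t y
      = downRate q 1 y * rowWeight q b m t (bump y 1 (-1)) := by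
  have hi : 1 ∈ Finset.Icc 1 m := Finset.mem_Icc.2 ⟨le_rfl, hm⟩
  rw [rowWeight_bump_one hb hm, rowWeight_eq hi, downRate, zpow_neg_one]
  have h := qBinom_pred_pred hq0 hq1 (y 1 - y 2) (y 1 - t 1)
  rw [show y 1 + -1 - y 2 = y 1 - y 2 - 1 by ring, show y 1 + -1 - t 1 = y 1 - t 1 - 1 by ring]
  linear_combination -(b⁻¹ * restWeight q b {1} m t y) * h

/-- Propagation of left jumps. -/
theorem rowWeight_left_succ (hq0 : 0 < q) (hq1 : q < 1) (hb : b ≠ 0) {i : ℕ} (hi : 1 ≤ i)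
    (him : i + 1 ≤ m) (ht : t (i + 1) ≤ t i) (hy : y (i + 1) ≤ y i) :
    downRate q i (bump t i 1) * rowWeight q b m (bump t i 1) y * pullProb q i y (bump t i 1)
      + b⁻¹ * (1 - q ^ (y (i + 1) - t (i + 1))) * rowWeight q b m t y
      = downRate q (i + 1) y * rowWeight q b m t (bump y (i + 1) (-1)) := by
  have hi1 : i ∈ Finset.Icc 1 m := Finset.mem_Icc.2 ⟨hi, by omega⟩
  have hi2 : i + 1 ∈ Finset.Icc 1 m := Finset.mem_Icc.2 ⟨by omega, him⟩
  rw [mul_right_comm, downRate_mul_pullProb hq0 hq1 ht, rowWeight_bump hb hi1,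
    rowWeight_bump_succ hb hi him, rowWeight_eq hi1, restWeight_singleton hi2 (by omega),
    Finset.pair_comm (i + 1) i, downRate, zpow_neg_one]
  -- The second Pascal rule splits the factor with index `i` between the same-index flow and the
  -- pull from entry `i`; absorption treats the factor with index `i + 1`.
  have h1 := qBinom_succ_succ' hq0 hq1 (m := y i - y (i + 1)) (by omega) (y i - t i)
  have h2 := qBinom_pred_pred hq0 hq1 (y (i + 1) - y (i + 2)) (y (i + 1) - t (i + 1))
  rw [show y i - y (i + 1) + 1 - (y i - t i) = t i + 1 - y (i + 1) by ring] at h1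
  rw [← sub_sub (y i),
    show y i - (y (i + 1) + -1) = y i - y (i + 1) + 1 by ring, h1,
    show y (i + 1) + -1 - y (i + 2) = y (i + 1) - y (i + 2) - 1 by ring,
    show y (i + 1) + -1 - t (i + 1) = y (i + 1) - t (i + 1) - 1 by ring]
  linear_combination -(b⁻¹ * restWeight q b {i, i + 1} m t y)
    * (qBinom q (y i - y (i + 1)) (y i - t i) + q ^ (t i + 1 - y (i + 1))
        * qBinom q (y i - y (i + 1)) (y i - t i - 1)) * h2

/-- Raising a blocked entry makes the upper argument of the preceding q-binomial negative. -/
theorem rowWeight_bump_eq_zero (hb : b ≠ 0) {i : ℕ} (hi : i ∈ Finset.Icc 1 m) (h1 : i ≠ 1)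
    (ht : t (i - 1) ≤ t i) : rowWeight q b m x (bump t i 1) = 0 := by
  obtain ⟨k, rfl⟩ : ∃ k, i = k + 2 := ⟨i - 2, by have := (Finset.mem_Icc.1 hi).1; omega⟩
  rw [rowWeight_bump_succ hb (by omega) (Finset.mem_Icc.1 hi).2, qBinom_eq_zero, mul_zero, zero_mul]
  rw [show k + 2 - 1 = k + 1 by omega] at ht
  rw [show k + 1 + 1 = k + 2 by omega]
  omega

/-- A suppressed right jump compensates the missing left jump one level above. -/
theorem rowWeight_suppressed (hq0 : 0 < q) (hq1 : q < 1) {c : ℝ} (hb : b ≠ 0) (hbc : b * c = 1)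
    {i : ℕ} (hi : i ∈ Finset.Icc 1 m) (ht : ∀ j, 1 ≤ j → t (j + 1) ≤ t j) :
    b⁻¹ * downRate q i (bump t i 1) * rowWeight q b m x (bump t i 1) * rowWeight q c m (bump t i 1) y
        * (1 - pullProb q i y (bump t i 1))
      = upRate q i t * rowWeight q b m x (bump t i 1) * rowWeight q c m t y
        * (1 - pushProb q i y t) := by
  have hi1 := (Finset.mem_Icc.1 hi).1
  have hc : c ≠ 0 := right_ne_zero_of_mul_eq_one hbc
  -- A blocked entry gives the push probability a zero denominator, but the raised row then has
  -- weight zero, so the default value of the division is irrelevant.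
  by_cases h : i ≠ 1 ∧ t (i - 1) ≤ t i
  · rw [rowWeight_bump_eq_zero hb hi h.1 h.2]
    ring
  · have h1 := upRate_mul_one_sub_pushProb hq0 hq1 (x := t) (i := i)
      (fun h1 => not_le.1 fun h2 => h ⟨h1, h2⟩) y
    have h2 := rowWeight_left_same (y := y) hq0 hq1 hc hi (ht i hi1)
    -- The inverse parameters of the two levels enter here.
    have h3 : b⁻¹ * c⁻¹ = 1 := by rw [← mul_inv, hbc, inv_one]
    linear_combination b⁻¹ * rowWeight q b m x (bump t i 1) * h2
      + (1 - q ^ (y i - t i)) * rowWeight q c m t y * rowWeight q b m x (bump t i 1) * h3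
      - rowWeight q b m x (bump t i 1) * rowWeight q c m t y * h1

end rowWeight

/-! ### Expansion of the cascade -/

theorem move_eq_update (u : ℕ → ℕ → ℤ) (k i : ℕ) (c : ℤ) :
    move u k i c = Function.update u k (bump (u k) i c) := by
  funext k' i'
  by_cases hk : k' = k
  · subst hk
    by_cases hi : i' = i
    · subst hi; simp [move, bump]
    · simp [move, bump, hi]
  · simp [move, hk]

theorem move_of_ne (u : ℕ → ℕ → ℤ) {k j : ℕ} (h : j ≠ k) (i : ℕ) (c : ℤ) : move u k i c j = u j := by
  rw [move_eq_update, Function.update_of_ne h]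

/-- A cascade that starts at level `k` does not change the levels above `k`. -/
theorem cascade_eq_zero {q : ℝ} {d : ℕ} {s : Dir} {k i j : ℕ} {u w : ℕ → ℕ → ℤ} (hj : j < k)
    (h : u j ≠ w j) : cascade q d s k i u w = 0 := by
  induction d generalizing s k i u with
  | zero =>
    cases s <;>
    · rw [cascade, if_neg]
      rintro rfl
      exact h (move_of_ne u hj.ne i _).symm
  | succ d ih =>
    have h1 : ∀ c, move u k i c j ≠ w j := fun c => by rwa [move_of_ne u hj.ne]
    cases s
    · simp only [cascade]
      rw [ih (by omega) (h1 1), ih (by omega) h, ih (by omega) (h1 1)]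
      simp
    · simp only [cascade]
      rw [ih (by omega) (h1 _), ih (by omega) (h1 _)]
      simp

section

variable {q : ℝ} {d k i : ℕ} {u w : ℕ → ℕ → ℤ}

theorem bump_bump_neg (x : ℕ → ℤ) (i : ℕ) (c : ℤ) : bump (bump x i c) i (-c) = x := by
  funext j
  by_cases h : j = i
  · subst h; simp [bump]
  · simp [bump, h]

theorem bump_eq_iff {x t : ℕ → ℤ} {i : ℕ} {c : ℤ} : bump x i c = t ↔ x = bump t i (-c) := by
  constructor
  · rintro rfl; rw [bump_bump_neg]
  · rintro rfl; simpa using bump_bump_neg t i (-c)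

open Classical in
-- The remaining cascade leaves row `k` alone, so that row must already equal its target after the
-- move; this determines `x`.
theorem cascade_move_update (hu : u k = w k) (x : ℕ → ℤ) (c : ℤ) (s : Dir) (i' : ℕ) :
    cascade q d s (k + 1) i' (move (Function.update u k x) k i c) w
      = if x = bump (w k) i (-c) then cascade q d s (k + 1) i' u w else 0 := by
  split_ifs with h
  · congr 1
    rw [move_eq_update, Function.update_idem, Function.update_self, bump_eq_iff.2 h, ← hu,
      Function.update_eq_self]
  · refine cascade_eq_zero (j := k) (by omega) ?_
    rw [move_eq_update, Function.update_self, Function.update_self]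
    exact fun hh => h (bump_eq_iff.1 hh)

open Classical in
theorem cascade_update (hu : u k = w k) (x : ℕ → ℤ) (s : Dir) (i' : ℕ) :
    cascade q d s (k + 1) i' (Function.update u k x) w
      = if x = w k then cascade q d s (k + 1) i' u w else 0 := by
  split_ifs with h
  · rw [h, ← hu, Function.update_eq_self]
  · refine cascade_eq_zero (j := k) (by omega) ?_
    rwa [Function.update_self]

variable {D : Finset (ℕ → ℤ)} (G : (ℕ → ℤ) → ℝ)

/-- A performed jump has a single source row, the target row with the jump undone. -/
theorem sum_mul_cascade_right (hu : u k = w k) (hs : k + 1 ≠ 2 * i) (hD : bump (w k) i (-1) ∈ D) :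
    ∑ x ∈ D, G x * cascade q (d + 1) Dir.right k i (Function.update u k x) w
      = G (bump (w k) i (-1)) *
        (pushProb q i (u (k + 1)) (bump (w k) i (-1)) * cascade q d Dir.right (k + 1) i u w
          + (1 - pushProb q i (u (k + 1)) (bump (w k) i (-1)))
            * cascade q d Dir.right (k + 1) (i + 1) u w) := by
  rw [Finset.sum_eq_single_of_mem _ hD]
  · simp only [cascade, if_neg hs]
    rw [cascade_move_update hu, cascade_move_update hu, if_pos rfl, if_pos rfl,
      Function.update_self, Function.update_of_ne (by omega)]
  · intro x _ hx
    simp only [cascade, if_neg hs]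
    rw [cascade_move_update hu, cascade_move_update hu, if_neg hx, if_neg hx]
    simp

open Classical in
-- At the wall there are two sources: the lowered row if the jump is performed, and the target row
-- itself if it is suppressed.
theorem sum_mul_cascade_right_last (hu : u k = w k) (hs : k + 1 = 2 * i)
    (hD : bump (w k) i (-1) ∈ D) (hD' : w k ∈ D) :
    ∑ x ∈ D, G x * cascade q (d + 1) Dir.right k i (Function.update u k x) w
      = G (bump (w k) i (-1)) *
        (pushProb q i (u (k + 1)) (bump (w k) i (-1)) * cascade q d Dir.right (k + 1) i u w)
        + G (w k) * ((1 - pushProb q i (u (k + 1)) (w k)) * cascade q d Dir.left (k + 1) i u w) := by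
  have h : ∀ x, G x * cascade q (d + 1) Dir.right k i (Function.update u k x) w
      = G x * (pushProb q i (u (k + 1)) x * if x = bump (w k) i (-1) then
          cascade q d Dir.right (k + 1) i u w else 0)
        + G x * ((1 - pushProb q i (u (k + 1)) x) * if x = w k then
          cascade q d Dir.left (k + 1) i u w else 0) := by
    intro x
    simp only [cascade, if_pos hs]
    rw [cascade_move_update hu, cascade_update hu,
      Function.update_self, Function.update_of_ne (by omega), mul_add]
  simp_rw [h]
  rw [Finset.sum_add_distrib, Finset.sum_eq_single_of_mem _ hD, Finset.sum_eq_single_of_mem _ hD',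
    if_pos rfl, if_pos rfl]
  · intro x _ hx; rw [if_neg hx]; simp
  · intro x _ hx; rw [if_neg hx]; simp

theorem sum_mul_cascade_left (hu : u k = w k) (hD : bump (w k) i 1 ∈ D) :
    ∑ x ∈ D, G x * cascade q (d + 1) Dir.left k i (Function.update u k x) w
      = G (bump (w k) i 1) *
        (pullProb q i (u (k + 1)) (bump (w k) i 1) * cascade q d Dir.left (k + 1) (i + 1) u w
          + (1 - pullProb q i (u (k + 1)) (bump (w k) i 1))
            * cascade q d Dir.left (k + 1) i u w) := by
  rw [Finset.sum_eq_single_of_mem _ hD]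
  · simp only [cascade]
    rw [cascade_move_update hu, cascade_move_update hu, neg_neg, if_pos rfl, if_pos rfl,
      Function.update_self, Function.update_of_ne (by omega)]
  · intro x _ hx
    simp only [cascade]
    rw [cascade_move_update hu, cascade_move_update hu, neg_neg, if_neg hx, if_neg hx]
    simp

end

/-- Entry `i + 1` receives `ρ` from its own index and `ρ'` from index `i`; the first entry receives
the constant `c` in place of `ρ'`. The term with index `m + 1` stands apart because the upper row
may lack that entry. -/
theorem sum_Icc_propagate {ρ ρ' r C : ℕ → ℝ} {c : ℝ} (m : ℕ) (h1 : r 1 = ρ 1 + c)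
    (h : ∀ i, 1 ≤ i → i ≤ m → r (i + 1) = ρ (i + 1) + ρ' i) :
    ∑ i ∈ Finset.Icc 1 m, ρ i * C i + ∑ i ∈ Finset.Icc 1 m, ρ' i * C (i + 1) + c * C 1
      + ρ (m + 1) * C (m + 1) = ∑ i ∈ Finset.Icc 1 (m + 1), r i * C i := by
  induction m with
  | zero => simp [h1]; ring
  | succ m ih =>
    rw [Finset.sum_Icc_succ_top (by omega) (fun i => r i * C i),
      ← ih fun i hi him => h i hi (by omega), h (m + 1) (by omega) le_rfl,
      Finset.sum_Icc_succ_top (by omega), Finset.sum_Icc_succ_top (by omega)]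
    ring

/-! ### The sum over the sources of a jump, level by level -/

/-- The number of entries of level `k`. -/
def levelSize (k : ℕ) : ℕ := (k + 1) / 2

/-- The rate of the clock of the first particle of level `k`. -/
noncomputable def levelParam (a : ℕ → ℝ) (k : ℕ) : ℝ :=
  if k % 2 = 1 then a ((k + 1) / 2) else (a (k / 2))⁻¹

/-- The weight of the levels `k - 1` and `k`. -/
noncomputable def stepWeight (q : ℝ) (a : ℕ → ℝ) (k : ℕ) (x y : ℕ → ℤ) : ℝ :=
  rowWeight q (levelParam a k) (levelSize k) x y

/-- The weight of the levels `k, ..., N`. -/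
noncomputable def tailWeight (q : ℝ) (a : ℕ → ℝ) (N k : ℕ) (u : ℕ → ℕ → ℤ) : ℝ :=
  ∏ j ∈ Finset.Icc (k + 1) N, stepWeight q a j (u (j - 1)) (u j)

/-- The rate of an attempted right jump of the `i`-th entry of level `k` from `x`. -/
noncomputable def rightRate (q : ℝ) (a : ℕ → ℝ) (k i : ℕ) (v x : ℕ → ℤ) : ℝ :=
  upRate q i x * stepWeight q a k v (bump x i 1)

/-- The rate of a left jump of the `i`-th entry of level `k` from `x`. -/
noncomputable def leftRate (q : ℝ) (a : ℕ → ℝ) (k i : ℕ) (v x : ℕ → ℤ) : ℝ :=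
  downRate q i x * stepWeight q a k v (bump x i (-1))
    - if k + 1 = 2 * i then (levelParam a k)⁻¹ * (1 - q ^ x i) * stepWeight q a k v x else 0

/-- The total rate of the jumps to `w` when the levels above `k` have been summed out. -/
noncomputable def levelRate (q : ℝ) (a : ℕ → ℝ) (N : ℕ) (w : ℕ → ℕ → ℤ) (k : ℕ)
    (u : ℕ → ℕ → ℤ) : ℝ :=
  tailWeight q a (k - 1) 0 w * tailWeight q a N k u *
      ∑ i ∈ Finset.Icc 1 (levelSize k),
        (rightRate q a k i (w (k - 1)) (u k) * cascade q (N - k) Dir.right k i u w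
          + leftRate q a k i (w (k - 1)) (u k) * cascade q (N - k) Dir.left k i u w)
    + ∑ j ∈ Finset.Icc (k + 1) N,
        levelParam a j * tailWeight q a N 0 u * cascade q (N - j) Dir.right j 1 u w

section

variable {q : ℝ} {a : ℕ → ℝ} {N k : ℕ} {u w : ℕ → ℕ → ℤ}

theorem tailWeight_eq (hk : k < N) :
    tailWeight q a N k u = stepWeight q a (k + 1) (u k) (u (k + 1)) * tailWeight q a N (k + 1) u := by
  rw [tailWeight, tailWeight, ← Finset.insert_Icc_add_one_left_eq_Icc (by omega : k + 1 ≤ N),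
    Finset.prod_insert (by simp), Nat.add_sub_cancel]

theorem tailWeight_zero_succ (k : ℕ) :
    tailWeight q a (k + 1) 0 w = tailWeight q a k 0 w * stepWeight q a (k + 1) (w k) (w (k + 1)) := by
  rw [tailWeight, tailWeight, Finset.prod_Icc_succ_top (by omega), Nat.add_sub_cancel]

theorem tailWeight_congr {u' : ℕ → ℕ → ℤ} (h : ∀ j, k ≤ j → j ≤ N → u j = u' j) :
    tailWeight q a N k u = tailWeight q a N k u' := by
  refine Finset.prod_congr rfl fun j hj => ?_
  have := Finset.mem_Icc.1 hj
  rw [h _ (by omega) (by omega), h _ (by omega) (by omega)]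

theorem tailWeight_mul (hk : k ≤ N) :
    tailWeight q a N 0 u = tailWeight q a k 0 u * tailWeight q a N k u := by
  rw [tailWeight, tailWeight, tailWeight, ← Finset.prod_union]
  · congr 1
    ext j
    simp only [Finset.mem_union, Finset.mem_Icc]
    omega
  · refine Finset.disjoint_left.2 fun j h1 h2 => ?_
    simp only [Finset.mem_Icc] at h1 h2
    omega

end

section

variable {q b : ℝ} {m : ℕ} {t y : ℕ → ℤ}

/-- The right jumps that a row `y` with `m + 1` entries receives from a row with `m` entries. -/
theorem sum_rowWeight_right (hq0 : 0 < q) (hq1 : q < 1) (hb : b ≠ 0)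
    (ht : ∀ j, 1 ≤ j → t (j + 1) ≤ t j) (hy : ∀ j, 1 ≤ j → y (j + 1) ≤ y j) {M : ℕ} (hM : m + 1 ≤ M)
    (C : ℕ → ℝ) :
    ∑ i ∈ Finset.Icc 1 m, upRate q i (bump t i (-1)) * rowWeight q b M (bump t i (-1)) y
        * pushProb q i y (bump t i (-1)) * C i
      + ∑ i ∈ Finset.Icc 1 m, upRate q i (bump t i (-1)) * rowWeight q b M (bump t i (-1)) y
        * (1 - pushProb q i y (bump t i (-1))) * C (i + 1)
      + b * rowWeight q b M t y * C 1
      + upRate q (m + 1) (bump t (m + 1) (-1)) * rowWeight q b M (bump t (m + 1) (-1)) y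
        * pushProb q (m + 1) y (bump t (m + 1) (-1)) * C (m + 1)
      = ∑ i ∈ Finset.Icc 1 (m + 1), upRate q i y * rowWeight q b M t (bump y i 1) * C i := by
  refine sum_Icc_propagate m ?_ fun i hi him => ?_
  · exact (rowWeight_right_one hq0 hq1 hb (by omega) (hy 1 le_rfl)).symm
  · exact (rowWeight_right_succ hq0 hq1 hb hi (by omega) ht (hy (i + 1) (by omega))).symm

/-- The left jumps that a row `y` with `m + 1` entries receives from a row with `m` entries. -/
theorem sum_rowWeight_left (hq0 : 0 < q) (hq1 : q < 1) (hb : b ≠ 0)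
    (ht : ∀ j, 1 ≤ j → t (j + 1) ≤ t j) (hy : ∀ j, 1 ≤ j → y (j + 1) ≤ y j) {M : ℕ} (hM : m + 1 ≤ M)
    (C : ℕ → ℝ) :
    ∑ i ∈ Finset.Icc 1 m, downRate q i (bump t i 1) * rowWeight q b M (bump t i 1) y
        * (1 - pullProb q i y (bump t i 1)) * C i
      + ∑ i ∈ Finset.Icc 1 m, downRate q i (bump t i 1) * rowWeight q b M (bump t i 1) y
        * pullProb q i y (bump t i 1) * C (i + 1)
      + b⁻¹ * (1 - q ^ (y (m + 1) - t (m + 1))) * rowWeight q b M t y * C (m + 1)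
      = ∑ i ∈ Finset.Icc 1 (m + 1), downRate q i y * rowWeight q b M t (bump y i (-1)) * C i := by
  have h := sum_Icc_propagate (c := 0) (C := C)
    (ρ := fun i => b⁻¹ * (1 - q ^ (y i - t i)) * rowWeight q b M t y)
    (ρ' := fun i => downRate q i (bump t i 1) * rowWeight q b M (bump t i 1) y
        * pullProb q i y (bump t i 1))
    (r := fun i => downRate q i y * rowWeight q b M t (bump y i (-1))) m
    (by rw [add_zero]; exact (rowWeight_left_one hq0 hq1 hb (by omega)).symm)
    (fun i hi him => by
      exact (rowWeight_left_succ hq0 hq1 hb hi (by omega) (ht i hi) (hy i hi)).symm.trans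
        (add_comm _ _))
  rw [← h, zero_mul, add_zero]
  congr 2
  refine Finset.sum_congr rfl fun i hi => ?_
  have := Finset.mem_Icc.1 hi
  rw [rowWeight_left_same hq0 hq1 hb (Finset.mem_Icc.2 ⟨this.1, by omega⟩) (ht i this.1)]

/-- Lowering a zero entry breaks interlacing. This removes the push from the entry that an even
level does not have. -/
theorem rowWeight_bump_last (hb : b ≠ 0) (hm : 1 ≤ m) (ht : t m = 0) (hy : y (m + 1) = 0) :
    rowWeight q b m (bump t m (-1)) y = 0 := by
  rw [rowWeight_bump hb (Finset.mem_Icc.2 ⟨hm, le_rfl⟩), qBinom_eq_zero, mul_zero]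
  omega

end

theorem levelSize_even (p : ℕ) : levelSize (2 * p) = p := by unfold levelSize; omega
theorem levelSize_odd (p : ℕ) : levelSize (2 * p + 1) = p + 1 := by unfold levelSize; omega

section

variable {q : ℝ} {a : ℕ → ℝ} {k : ℕ} {v t y : ℕ → ℤ}

theorem rightRate_bump (i : ℕ) :
    rightRate q a k i v (bump t i (-1)) = upRate q i (bump t i (-1)) * stepWeight q a k v t := by
  have h := bump_bump_neg t i (-1)
  rw [neg_neg] at h
  rw [rightRate, h]

theorem leftRate_bump {i : ℕ} (hi : k + 1 ≠ 2 * i) :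
    leftRate q a k i v (bump t i 1) = downRate q i (bump t i 1) * stepWeight q a k v t := by
  rw [leftRate, bump_bump_neg, if_neg hi, sub_zero]

/-- From an even level to the next level. -/
theorem levelRate_step_even (hq0 : 0 < q) (hq1 : q < 1) {p : ℕ} (hb : levelParam a (2 * p + 1) ≠ 0)
    (ht : ∀ j, 1 ≤ j → t (j + 1) ≤ t j) (hy : ∀ j, 1 ≤ j → y (j + 1) ≤ y j)
    (ht0 : t (p + 1) = 0) (hy0 : y (p + 2) = 0) {A B : ℝ}
    (hAB : 1 ≤ p → A * stepWeight q a (2 * p) v t = B) (R L : ℕ → ℝ) :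
    A * ∑ i ∈ Finset.Icc 1 p,
        (rightRate q a (2 * p) i v (bump t i (-1)) * stepWeight q a (2 * p + 1) (bump t i (-1)) y *
          (pushProb q i y (bump t i (-1)) * R i + (1 - pushProb q i y (bump t i (-1))) * R (i + 1))
        + leftRate q a (2 * p) i v (bump t i 1) * stepWeight q a (2 * p + 1) (bump t i 1) y *
          (pullProb q i y (bump t i 1) * L (i + 1) + (1 - pullProb q i y (bump t i 1)) * L i))
      + B * (levelParam a (2 * p + 1) * stepWeight q a (2 * p + 1) t y * R 1)
      = B * ∑ i ∈ Finset.Icc 1 (p + 1),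
          (rightRate q a (2 * p + 1) i t y * R i + leftRate q a (2 * p + 1) i t y * L i) := by
  have h1 := sum_rowWeight_right (m := p) hq0 hq1 hb ht hy le_rfl R
  have h2 := sum_rowWeight_left (m := p) hq0 hq1 hb ht hy le_rfl L
  rw [rowWeight_bump_last hb (by omega) ht0 hy0] at h1
  -- The relation between `A` and `B` is available for `p ≥ 1` only; at level `0` both sums are
  -- empty.
  have hA : ∀ X : ℕ → ℝ, A * ∑ i ∈ Finset.Icc 1 p, stepWeight q a (2 * p) v t * X i
      = B * ∑ i ∈ Finset.Icc 1 p, X i := by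
    intro X
    rcases Nat.eq_zero_or_pos p with rfl | hp
    · simp
    · rw [← Finset.mul_sum, ← mul_assoc, hAB hp]
  -- The new last entry gets no left flow, as its partner in `t` does not exist. With `t (p + 1) =
  -- 0` the missing term is the correction built into `leftRate`.
  have h3 : ∑ i ∈ Finset.Icc 1 (p + 1),
          (rightRate q a (2 * p + 1) i t y * R i + leftRate q a (2 * p + 1) i t y * L i)
      = ∑ i ∈ Finset.Icc 1 (p + 1), upRate q i y
          * rowWeight q (levelParam a (2 * p + 1)) (p + 1) t (bump y i 1) * R i
        + (∑ i ∈ Finset.Icc 1 (p + 1), downRate q i y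
          * rowWeight q (levelParam a (2 * p + 1)) (p + 1) t (bump y i (-1)) * L i
          - (levelParam a (2 * p + 1))⁻¹ * (1 - q ^ y (p + 1))
            * rowWeight q (levelParam a (2 * p + 1)) (p + 1) t y * L (p + 1)) := by
    rw [Finset.sum_add_distrib]
    congr 1
    · simp only [rightRate, stepWeight, levelSize_odd]
    · rw [Finset.sum_Icc_succ_top (by omega), Finset.sum_Icc_succ_top (by omega), add_sub_assoc]
      congr 1
      · refine Finset.sum_congr rfl fun i hi => ?_
        have := Finset.mem_Icc.1 hi
        rw [leftRate, if_neg (by omega), sub_zero, stepWeight, levelSize_odd]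
      · rw [leftRate, if_pos (by omega), stepWeight, stepWeight, levelSize_odd]
        ring
  rw [h3, ← h1, ← h2, ht0]
  have h4 : ∀ i ∈ Finset.Icc 1 p,
      rightRate q a (2 * p) i v (bump t i (-1)) * stepWeight q a (2 * p + 1) (bump t i (-1)) y *
          (pushProb q i y (bump t i (-1)) * R i + (1 - pushProb q i y (bump t i (-1))) * R (i + 1))
        + leftRate q a (2 * p) i v (bump t i 1) * stepWeight q a (2 * p + 1) (bump t i 1) y *
          (pullProb q i y (bump t i 1) * L (i + 1) + (1 - pullProb q i y (bump t i 1)) * L i)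
      = stepWeight q a (2 * p) v t *
        (upRate q i (bump t i (-1)) * rowWeight q (levelParam a (2 * p + 1)) (p + 1) (bump t i (-1)) y
          * pushProb q i y (bump t i (-1)) * R i
        + upRate q i (bump t i (-1)) * rowWeight q (levelParam a (2 * p + 1)) (p + 1) (bump t i (-1)) y
          * (1 - pushProb q i y (bump t i (-1))) * R (i + 1)
        + (downRate q i (bump t i 1) * rowWeight q (levelParam a (2 * p + 1)) (p + 1) (bump t i 1) y
          * (1 - pullProb q i y (bump t i 1)) * L i
        + downRate q i (bump t i 1) * rowWeight q (levelParam a (2 * p + 1)) (p + 1) (bump t i 1) y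
          * pullProb q i y (bump t i 1) * L (i + 1))) := by
    intro i _
    rw [rightRate_bump, leftRate_bump (by omega), stepWeight.eq_1 q a (2 * p + 1),
      stepWeight.eq_1 q a (2 * p + 1), levelSize_odd]
    ring
  rw [Finset.sum_congr rfl h4, hA, Finset.sum_add_distrib, Finset.sum_add_distrib,
    Finset.sum_add_distrib, stepWeight, levelSize_odd, sub_zero]
  ring

/-- From an odd level to the next level. -/
theorem levelRate_step_odd (hq0 : 0 < q) (hq1 : q < 1) {p : ℕ} (hb : levelParam a (2 * p + 1) ≠ 0)
    (hbc : levelParam a (2 * p + 1) * levelParam a (2 * p + 2) = 1)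
    (ht : ∀ j, 1 ≤ j → t (j + 1) ≤ t j) (hy : ∀ j, 1 ≤ j → y (j + 1) ≤ y j)
    (ht0 : t (p + 2) = 0) (hy0 : y (p + 2) = 0) {A B : ℝ}
    (hAB : A * stepWeight q a (2 * p + 1) v t = B) (R L : ℕ → ℝ) :
    A * (∑ i ∈ Finset.Icc 1 p,
        (rightRate q a (2 * p + 1) i v (bump t i (-1)) * stepWeight q a (2 * p + 2) (bump t i (-1)) y *
          (pushProb q i y (bump t i (-1)) * R i + (1 - pushProb q i y (bump t i (-1))) * R (i + 1))
        + leftRate q a (2 * p + 1) i v (bump t i 1) * stepWeight q a (2 * p + 2) (bump t i 1) y *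
          (pullProb q i y (bump t i 1) * L (i + 1) + (1 - pullProb q i y (bump t i 1)) * L i))
        + (rightRate q a (2 * p + 1) (p + 1) v (bump t (p + 1) (-1))
            * stepWeight q a (2 * p + 2) (bump t (p + 1) (-1)) y
            * (pushProb q (p + 1) y (bump t (p + 1) (-1)) * R (p + 1))
          + rightRate q a (2 * p + 1) (p + 1) v t * stepWeight q a (2 * p + 2) t y
            * ((1 - pushProb q (p + 1) y t) * L (p + 1))
          + leftRate q a (2 * p + 1) (p + 1) v (bump t (p + 1) 1)
            * stepWeight q a (2 * p + 2) (bump t (p + 1) 1) y *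
          (pullProb q (p + 1) y (bump t (p + 1) 1) * L (p + 2)
            + (1 - pullProb q (p + 1) y (bump t (p + 1) 1)) * L (p + 1))))
      + B * (levelParam a (2 * p + 2) * stepWeight q a (2 * p + 2) t y * R 1)
      = B * ∑ i ∈ Finset.Icc 1 (p + 1),
          (rightRate q a (2 * p + 2) i t y * R i + leftRate q a (2 * p + 2) i t y * L i) := by
  have hc : levelParam a (2 * p + 2) ≠ 0 := right_ne_zero_of_mul_eq_one hbc
  have hsize : levelSize (2 * p + 2) = p + 1 := by unfold levelSize; omega
  have h1 := sum_rowWeight_right (m := p) hq0 hq1 hc ht hy le_rfl R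
  have h2 := sum_rowWeight_left (m := p) hq0 hq1 hc ht hy le_rfl L
  have h3 : ∑ i ∈ Finset.Icc 1 (p + 1),
          (rightRate q a (2 * p + 2) i t y * R i + leftRate q a (2 * p + 2) i t y * L i)
      = ∑ i ∈ Finset.Icc 1 (p + 1), upRate q i y
          * rowWeight q (levelParam a (2 * p + 2)) (p + 1) t (bump y i 1) * R i
        + ∑ i ∈ Finset.Icc 1 (p + 1), downRate q i y
          * rowWeight q (levelParam a (2 * p + 2)) (p + 1) t (bump y i (-1)) * L i := by
    rw [← Finset.sum_add_distrib]
    refine Finset.sum_congr rfl fun i _ => ?_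
    rw [rightRate, leftRate, if_neg (by omega), sub_zero, stepWeight, stepWeight, hsize]
  have hmem : p + 1 ∈ Finset.Icc 1 (p + 1) := Finset.mem_Icc.2 ⟨by omega, le_rfl⟩
  have h5 := rowWeight_left_same (y := y) hq0 hq1 hc hmem (ht (p + 1) (by omega))
  -- The defect inherited from the odd level cancels against the suppressed right jumps, leaving
  -- `h5` as the ordinary same-index flow.
  have h6 := rowWeight_suppressed (x := v) (y := y) hq0 hq1 hb hbc hmem ht
  -- The last entry can pull only its own index: position `p + 2` is zero in both rows, so the
  -- numerator vanishes.
  have h7 : pullProb q (p + 1) y (bump t (p + 1) 1) = 0 := by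
    rw [pullProb, bump_of_ne t (by omega : p + 1 + 1 ≠ p + 1), ht0, hy0]
    simp
  have h8 : downRate q (p + 1) (bump t (p + 1) 1) = 1 - q ^ (bump t (p + 1) 1 (p + 1)) := by
    rw [downRate, bump_of_ne t (by omega : p + 1 + 1 ≠ p + 1), ht0, sub_zero]
  rw [h3, ← h1, ← h2]
  have h4 : ∀ i ∈ Finset.Icc 1 p,
      rightRate q a (2 * p + 1) i v (bump t i (-1)) * stepWeight q a (2 * p + 2) (bump t i (-1)) y *
          (pushProb q i y (bump t i (-1)) * R i + (1 - pushProb q i y (bump t i (-1))) * R (i + 1))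
        + leftRate q a (2 * p + 1) i v (bump t i 1) * stepWeight q a (2 * p + 2) (bump t i 1) y *
          (pullProb q i y (bump t i 1) * L (i + 1) + (1 - pullProb q i y (bump t i 1)) * L i)
      = stepWeight q a (2 * p + 1) v t *
        (upRate q i (bump t i (-1)) * rowWeight q (levelParam a (2 * p + 2)) (p + 1) (bump t i (-1)) y
          * pushProb q i y (bump t i (-1)) * R i
        + upRate q i (bump t i (-1)) * rowWeight q (levelParam a (2 * p + 2)) (p + 1) (bump t i (-1)) y
          * (1 - pushProb q i y (bump t i (-1))) * R (i + 1)
        + (downRate q i (bump t i 1) * rowWeight q (levelParam a (2 * p + 2)) (p + 1) (bump t i 1) y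
          * (1 - pullProb q i y (bump t i 1)) * L i
        + downRate q i (bump t i 1) * rowWeight q (levelParam a (2 * p + 2)) (p + 1) (bump t i 1) y
          * pullProb q i y (bump t i 1) * L (i + 1))) := by
    intro i hi
    have := Finset.mem_Icc.1 hi
    rw [rightRate_bump, leftRate_bump (by omega), stepWeight.eq_1 q a (2 * p + 2),
      stepWeight.eq_1 q a (2 * p + 2), hsize]
    ring
  rw [Finset.sum_congr rfl h4, ← Finset.mul_sum, Finset.sum_add_distrib, Finset.sum_add_distrib,
    Finset.sum_add_distrib, rightRate_bump, rightRate, leftRate, bump_bump_neg, if_pos (by omega),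
    stepWeight.eq_1 q a (2 * p + 2), stepWeight.eq_1 q a (2 * p + 2),
    stepWeight.eq_1 q a (2 * p + 2), hsize]
  simp only [h7, sub_zero, mul_one] at h5 h6 ⊢
  rw [h8] at h5 h6 ⊢
  simp only [stepWeight, levelSize_odd] at hAB ⊢
  subst hAB
  linear_combination A * rowWeight q (levelParam a (2 * p + 1)) (p + 1) v t * L (p + 1) * h5
    - A * L (p + 1) * h6

end

/-- A nonzero q-binomial has its arguments in range, which is interlacing at that index. This allows
sums over arbitrary integer rows in place of patterns. -/
theorem interlaced_of_rowWeight_ne_zero {q b : ℝ} {m : ℕ} {x y : ℕ → ℤ}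
    (h : rowWeight q b m x y ≠ 0) (hx : ∀ i, m < i → x i = 0) (hy : ∀ i, m < i → y i = 0) :
    Interlaced x y := by
  intro i hi
  by_cases him : i ≤ m
  · have h1 := Finset.prod_ne_zero_iff.1 (right_ne_zero_of_mul h) i (Finset.mem_Icc.2 ⟨hi, him⟩)
    by_contra h2
    exact h1 (qBinom_eq_zero (by omega))
  · rw [hx i (by omega), hy i (by omega), hy (i + 1) (by omega)]
    exact ⟨le_rfl, le_rfl⟩

theorem Interlaced.antitone_left {x y : ℕ → ℤ} (h : Interlaced x y) (i : ℕ) (hi : 1 ≤ i) :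
    x (i + 1) ≤ x i := (h (i + 1) (by omega)).2.trans (h i hi).1

theorem Interlaced.antitone_right {x y : ℕ → ℤ} (h : Interlaced x y) (i : ℕ) (hi : 1 ≤ i) :
    y (i + 1) ≤ y i := (h i hi).1.trans (h i hi).2

theorem levelSize_mono {j k : ℕ} (h : j ≤ k) : levelSize j ≤ levelSize k := by
  unfold levelSize; omega

/-- Isolates the dependence on row `k`: in the jump part, `x` enters the weight only through the
rates and the factor of level `k + 1`. The cascade length is put in successor form, ready to unfold
once. -/
theorem levelRate_update {q : ℝ} {a : ℕ → ℝ} {N k : ℕ} (hk : k < N) (u w : ℕ → ℕ → ℤ)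
    (x : ℕ → ℤ) :
    levelRate q a N w k (Function.update u k x)
      = tailWeight q a (k - 1) 0 w * tailWeight q a N (k + 1) u *
        ∑ i ∈ Finset.Icc 1 (levelSize k),
          (rightRate q a k i (w (k - 1)) x * stepWeight q a (k + 1) x (u (k + 1))
              * cascade q (N - (k + 1) + 1) Dir.right k i (Function.update u k x) w
            + leftRate q a k i (w (k - 1)) x * stepWeight q a (k + 1) x (u (k + 1))
              * cascade q (N - (k + 1) + 1) Dir.left k i (Function.update u k x) w)
      + ∑ j ∈ Finset.Icc (k + 1) N, levelParam a j * tailWeight q a N 0 (Function.update u k x)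
          * cascade q (N - j) Dir.right j 1 (Function.update u k x) w := by
  rw [levelRate, tailWeight_eq hk, Function.update_self, Function.update_of_ne (by omega),
    tailWeight_congr (k := k + 1) (u := Function.update u k x) (u' := u) fun j h1 h2 =>
      Function.update_of_ne (by omega) _ _,
    show N - k = N - (k + 1) + 1 by omega]
  congr 1
  rw [Finset.mul_sum, Finset.mul_sum]
  refine Finset.sum_congr rfl fun i _ => ?_
  ring

/-- Summing out level `k`. -/
theorem sum_levelRate_update {q : ℝ} (hq0 : 0 < q) (hq1 : q < 1) {a : ℕ → ℝ} {N k : ℕ}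
    (hk : k < N) (hb : ∀ j, 1 ≤ j → j ≤ N → levelParam a j ≠ 0)
    (hbc : ∀ p, 2 * p + 2 ≤ N → levelParam a (2 * p + 1) * levelParam a (2 * p + 2) = 1)
    {u w : ℕ → ℕ → ℤ} (hu : ∀ j, j ≤ k → u j = w j)
    (hw : ∀ j, 1 ≤ j → w k (j + 1) ≤ w k j) (hw0 : ∀ j, levelSize k < j → w k j = 0)
    (hy0 : ∀ j, levelSize (k + 1) < j → u (k + 1) j = 0)
    (hy : tailWeight q a N (k + 1) u ≠ 0 → ∀ j, 1 ≤ j → u (k + 1) (j + 1) ≤ u (k + 1) j)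
    {D : Finset (ℕ → ℤ)} (hD : w k ∈ D)
    (hD1 : ∀ i ∈ Finset.Icc 1 (levelSize k), bump (w k) i 1 ∈ D)
    (hD2 : ∀ i ∈ Finset.Icc 1 (levelSize k), bump (w k) i (-1) ∈ D) :
    ∑ x ∈ D, levelRate q a N w k (Function.update u k x) = levelRate q a N w (k + 1) u := by
  have huk := hu k le_rfl
  -- Clocks below level `k` never touch row `k`, so that row must already be the target row.
  have hclock : ∑ x ∈ D, ∑ j ∈ Finset.Icc (k + 1) N,
      levelParam a j * tailWeight q a N 0 (Function.update u k x)
          * cascade q (N - j) Dir.right j 1 (Function.update u k x) w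
      = ∑ j ∈ Finset.Icc (k + 1) N,
        levelParam a j * tailWeight q a N 0 u * cascade q (N - j) Dir.right j 1 u w := by
    rw [Finset.sum_eq_single_of_mem _ hD]
    · rw [← huk, Function.update_eq_self]
    · intro x _ hx
      refine Finset.sum_eq_zero fun j hj => ?_
      rw [cascade_eq_zero (j := k) (by have := (Finset.mem_Icc.1 hj).1; omega) (by
        rwa [Function.update_self]), mul_zero]
  have hB : tailWeight q a k 0 u = tailWeight q a k 0 w :=
    tailWeight_congr fun j _ h => hu j h
  have hAB : 1 ≤ k → tailWeight q a (k - 1) 0 w * stepWeight q a k (w (k - 1)) (w k)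
      = tailWeight q a k 0 w := by
    intro h
    obtain ⟨k, rfl⟩ : ∃ k', k = k' + 1 := ⟨k - 1, by omega⟩
    rw [tailWeight_zero_succ, Nat.add_sub_cancel]
  simp_rw [levelRate_update hk]
  -- The clock of level `k + 1` leaves the clock sum and joins the jumps of that level as a right
  -- jump of its first entry.
  rw [Finset.sum_add_distrib, hclock, levelRate, ← Finset.mul_sum, Finset.sum_comm,
    ← Finset.insert_Icc_add_one_left_eq_Icc (by omega : k + 1 ≤ N), Finset.sum_insert (by simp),
    ← add_assoc, Nat.add_sub_cancel]
  congr 1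
  rw [tailWeight_mul (u := u) (k := k) hk.le, tailWeight_eq hk, hB, huk]
  -- Row `k + 1` is known to be nonincreasing only if the remaining weight is nonzero; otherwise
  -- both sides are zero.
  by_cases hT : tailWeight q a N (k + 1) u = 0
  · simp [hT]
  replace hy := hy hT
  simp_rw [Finset.sum_add_distrib]
  rw [← Finset.sum_add_distrib]
  obtain ⟨p, rfl | rfl⟩ : ∃ p, k = 2 * p ∨ k = 2 * p + 1 := ⟨k / 2, by omega⟩
  · have hs : levelSize (2 * p) = p := levelSize_even p
    have hs' : levelSize (2 * p + 1) = p + 1 := levelSize_odd p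
    have hstep := levelRate_step_even (v := w (2 * p - 1)) (t := w (2 * p)) (y := u (2 * p + 1))
      hq0 hq1 (hb (2 * p + 1) (by omega) (by omega)) hw hy
      (hw0 _ (by omega)) (hy0 _ (by omega)) (fun h => hAB (by omega))
      (fun i => cascade q (N - (2 * p + 1)) Dir.right (2 * p + 1) i u w)
      (fun i => cascade q (N - (2 * p + 1)) Dir.left (2 * p + 1) i u w)
    have h1 : ∀ i ∈ Finset.Icc 1 p, _ := fun i hi => congrArg₂ (· + ·)
      (sum_mul_cascade_right (q := q) (d := N - (2 * p + 1)) (D := D)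
        (fun x => rightRate q a (2 * p) i (w (2 * p - 1)) x
          * stepWeight q a (2 * p + 1) x (u (2 * p + 1))) huk (i := i) (by omega)
        (hD2 i (by rwa [hs])))
      (sum_mul_cascade_left (q := q) (d := N - (2 * p + 1)) (D := D)
        (fun x => leftRate q a (2 * p) i (w (2 * p - 1)) x
          * stepWeight q a (2 * p + 1) x (u (2 * p + 1))) huk (i := i)
        (hD1 i (by rwa [hs])))
    rw [hs, hs', Finset.sum_congr rfl h1, ← Finset.sum_add_distrib]
    linear_combination tailWeight q a N (2 * p + 1) u * hstep
  · have hs : levelSize (2 * p + 1) = p + 1 := levelSize_odd p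
    have hs' : levelSize (2 * p + 1 + 1) = p + 1 := by unfold levelSize; omega
    have hstep := levelRate_step_odd (v := w (2 * p + 1 - 1)) (t := w (2 * p + 1))
      (y := u (2 * p + 2))
      hq0 hq1 (hb (2 * p + 1) (by omega) (by omega)) (hbc p (by omega)) hw hy
      (hw0 _ (by omega)) (hy0 _ (by omega)) (hAB (by omega))
      (fun i => cascade q (N - (2 * p + 2)) Dir.right (2 * p + 2) i u w)
      (fun i => cascade q (N - (2 * p + 2)) Dir.left (2 * p + 2) i u w)
    have h1 : ∀ i ∈ Finset.Icc 1 p, _ := fun i hi => congrArg₂ (· + ·)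
      (sum_mul_cascade_right (q := q) (d := N - (2 * p + 1 + 1)) (D := D)
        (fun x => rightRate q a (2 * p + 1) i (w (2 * p + 1 - 1)) x
          * stepWeight q a (2 * p + 1 + 1) x (u (2 * p + 1 + 1))) huk (i := i)
        (by have := Finset.mem_Icc.1 hi; omega)
        (hD2 i (by rw [hs]; exact Finset.Icc_subset_Icc_right (by omega) hi)))
      (sum_mul_cascade_left (q := q) (d := N - (2 * p + 1 + 1)) (D := D)
        (fun x => leftRate q a (2 * p + 1) i (w (2 * p + 1 - 1)) x
          * stepWeight q a (2 * p + 1 + 1) x (u (2 * p + 1 + 1))) huk (i := i)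
        (hD1 i (by rw [hs]; exact Finset.Icc_subset_Icc_right (by omega) hi)))
    have hmem : p + 1 ∈ Finset.Icc 1 (levelSize (2 * p + 1)) :=
      Finset.mem_Icc.2 ⟨by omega, by omega⟩
    have h2 := sum_mul_cascade_right_last (q := q) (d := N - (2 * p + 1 + 1)) (D := D)
        (fun x => rightRate q a (2 * p + 1) (p + 1) (w (2 * p + 1 - 1)) x
          * stepWeight q a (2 * p + 1 + 1) x (u (2 * p + 1 + 1))) huk (i := p + 1) (by omega)
        (hD2 _ hmem) hD
    have h3 := sum_mul_cascade_left (q := q) (d := N - (2 * p + 1 + 1)) (D := D)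
        (fun x => leftRate q a (2 * p + 1) (p + 1) (w (2 * p + 1 - 1)) x
          * stepWeight q a (2 * p + 1 + 1) x (u (2 * p + 1 + 1))) huk (i := p + 1)
        (hD1 _ hmem)
    rw [hs, hs', Finset.sum_Icc_succ_top (by omega), h2, h3, Finset.sum_congr rfl h1,
      ← Finset.sum_add_distrib]
    linear_combination tailWeight q a N (2 * p + 2) u * hstep

/-! ### Summation over all source arrays -/

section sources

variable {D : ℕ → Finset (ℕ → ℤ)} {N : ℕ} {base : ℕ → ℕ → ℤ}

open Classical in
/-- The arrays whose last `d` levels before level `N` are arbitrary rows from `D`, and whose other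
levels agree with `base`. -/
noncomputable def sources (D : ℕ → Finset (ℕ → ℤ)) (N : ℕ) (base : ℕ → ℕ → ℤ) :
    ℕ → Finset (ℕ → ℕ → ℤ)
  | 0 => {base}
  | d + 1 => (sources D N base d ×ˢ D (N - 1 - d)).image
      fun p => Function.update p.1 (N - 1 - d) p.2

theorem mem_sources {d : ℕ} (hd : d ≤ N) {u : ℕ → ℕ → ℤ} :
    u ∈ sources D N base d ↔ (∀ j, N - d ≤ j → j < N → u j ∈ D j) ∧
      ∀ j, ¬ (N - d ≤ j ∧ j < N) → u j = base j := by
  induction d generalizing u with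
  | zero =>
    simp only [sources, Finset.mem_singleton]
    constructor
    · rintro rfl
      exact ⟨fun j h1 h2 => by omega, fun _ _ => rfl⟩
    · rintro ⟨-, h⟩
      funext j
      rw [h j (by omega)]
  | succ d ih =>
    simp only [sources, Finset.mem_image, Finset.mem_product, Prod.exists]
    constructor
    · rintro ⟨v, x, ⟨hv, hx⟩, rfl⟩
      rw [ih (by omega)] at hv
      constructor
      · intro j h1 h2
        by_cases hj : j = N - 1 - d
        · subst hj; rwa [Function.update_self]
        · rw [Function.update_of_ne hj]; exact hv.1 j (by omega) h2
      · intro j hj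
        rw [Function.update_of_ne (by omega)]; exact hv.2 j (by omega)
    · rintro ⟨h1, h2⟩
      refine ⟨Function.update u (N - 1 - d) (base (N - 1 - d)), u (N - 1 - d), ⟨?_, ?_⟩, ?_⟩
      · rw [ih (by omega)]
        constructor
        · intro j h3 h4
          rw [Function.update_of_ne (by omega)]; exact h1 j (by omega) h4
        · intro j hj
          by_cases h : j = N - 1 - d
          · subst h; rw [Function.update_self]
          · rw [Function.update_of_ne h]; exact h2 j (by omega)
      · exact h1 _ (by omega) (by omega)
      · rw [Function.update_idem, Function.update_eq_self]

/-- The parametrisation is injective, because row `N - 1 - d` agrees with `base` before it is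
overwritten and can be restored. -/
theorem sum_sources_succ {d : ℕ} (hd : d + 1 ≤ N) (f : (ℕ → ℕ → ℤ) → ℝ) :
    ∑ u ∈ sources D N base (d + 1), f u
      = ∑ u ∈ sources D N base d, ∑ x ∈ D (N - 1 - d), f (Function.update u (N - 1 - d) x) := by
  classical
  rw [sources, Finset.sum_image, Finset.sum_product]
  rintro ⟨u, x⟩ h1 ⟨v, y⟩ h2 h
  simp only [Finset.coe_product, Set.mem_prod, Finset.mem_coe] at h1 h2 h
  have e1 := ((mem_sources (by omega)).1 h1.1).2 (N - 1 - d) (by omega)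
  have e2 := ((mem_sources (by omega)).1 h2.1).2 (N - 1 - d) (by omega)
  have e3 := congrFun h (N - 1 - d)
  rw [Function.update_self, Function.update_self] at e3
  have e4 := congrArg (fun z => Function.update z (N - 1 - d) (base (N - 1 - d))) h
  simp only [Function.update_idem] at e4
  rw [← e1, Function.update_eq_self, e1, ← e2, Function.update_eq_self] at e4
  rw [e3, e4]

end sources

/-- The rate factor of the shape in terms of the rates of its entries. -/
theorem stepFactor_eq (q : ℝ) {n : ℕ} (z z' : Shape n) [DecidableEq (ℕ → ℤ)] :
    stepFactor q z z' = ∑ i ∈ Finset.Icc 1 n,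
      (upRate q i z.part * (if z'.part = bump z.part i 1 then 1 else 0)
        + downRate q i z.part * (if z'.part = bump z.part i (-1) then 1 else 0)) := by
  refine Finset.sum_congr rfl fun i _ => ?_
  have h : z.part - Pi.single i 1 = bump z.part i (-1) := by
    rw [bump, Pi.single_neg, sub_eq_add_neg]
  rw [h, upRate, downRate, bump, mul_ite, mul_one, mul_zero, mul_ite, mul_one, mul_zero]
  congr

theorem Pattern.antitone {n : ℕ} (w : Pattern n) {k : ℕ} (j : ℕ) (hj : 1 ≤ j) :
    w.entry k (j + 1) ≤ w.entry k j := by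
  by_cases h : 1 ≤ k ∧ k ≤ 2 * n
  · rcases h.2.eq_or_lt with rfl | h2
    · exact w.shape.anti j hj
    · exact (w.interlaced k h.1 h2).antitone_left j hj
  · rw [w.support k j (by tauto), w.support k (j + 1) (by tauto)]

theorem Pattern.entry_eq_zero {n : ℕ} (w : Pattern n) {k j : ℕ} (hj : levelSize k < j) :
    w.entry k j = 0 := w.support k j (by unfold levelSize at hj; omega)

/-- The sum over the sources of the rates of the jumps to `w`. -/
theorem sum_sources {q : ℝ} (hq0 : 0 < q) (hq1 : q < 1) {a : ℕ → ℝ} {n : ℕ}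
    (hb : ∀ j, 1 ≤ j → j ≤ 2 * n → levelParam a j ≠ 0)
    (hbc : ∀ p, 2 * p + 2 ≤ 2 * n → levelParam a (2 * p + 1) * levelParam a (2 * p + 2) = 1)
    (z : Shape n) (w : Pattern n) {D : ℕ → Finset (ℕ → ℤ)}
    (hD : ∀ k, k < 2 * n → w.entry k ∈ D k)
    (hD1 : ∀ k, k < 2 * n → ∀ i ∈ Finset.Icc 1 (levelSize k), bump (w.entry k) i 1 ∈ D k)
    (hD2 : ∀ k, k < 2 * n → ∀ i ∈ Finset.Icc 1 (levelSize k), bump (w.entry k) i (-1) ∈ D k)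
    (hD0 : ∀ k, ∀ x ∈ D k, ∀ j, levelSize k < j → x j = 0) :
    ∑ u ∈ sources D (2 * n) (Function.update w.entry (2 * n) z.part) (2 * n),
      tailWeight q a (2 * n) 0 u * ∑ j ∈ Finset.Icc 1 (2 * n),
        levelParam a j * cascade q (2 * n - j) Dir.right j 1 u w.entry
      = tailWeight q a (2 * n) 0 w.entry * stepFactor q z w.shape := by
  classical
  set base := Function.update w.entry (2 * n) z.part with hbase
  have hz0 : ∀ j, levelSize (2 * n) < j → z.part j = 0 := fun j hj =>
    z.support j (by rw [levelSize_even] at hj; omega)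
  -- The innermost sum runs over the row of smallest level. Removing it turns `levelRate` at `2n - d
  -- - 1` into `levelRate` at `2n - d`.
  have key : ∀ d, d ≤ 2 * n → ∑ u ∈ sources D (2 * n) base d,
      levelRate q a (2 * n) w.entry (2 * n - d) u = levelRate q a (2 * n) w.entry (2 * n) base := by
    intro d
    induction d with
    | zero => intro _; simp [sources]
    | succ d ih =>
      intro hd
      rw [← ih (by omega), sum_sources_succ hd]
      refine Finset.sum_congr rfl fun u hu => ?_
      rw [mem_sources (by omega)] at hu
      have hrow : ∀ j, j ≤ 2 * n → ∀ i, levelSize j < i → u j i = 0 := by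
        intro j hj i hi
        by_cases h : 2 * n - d ≤ j ∧ j < 2 * n
        · exact hD0 j _ (hu.1 j h.1 h.2) i hi
        · rw [hu.2 j h, hbase]
          by_cases hj : j = 2 * n
          · subst hj; rw [Function.update_self]; exact hz0 i hi
          · rw [Function.update_of_ne hj]; exact w.entry_eq_zero hi
      have hlast : u (2 * n) = z.part := by
        rw [hu.2 _ (by omega), hbase, Function.update_self]
      have e1 : 2 * n - 1 - d = 2 * n - (d + 1) := by omega
      have e2 : 2 * n - d = 2 * n - (d + 1) + 1 := by omega
      rw [e1, e2]
      refine sum_levelRate_update hq0 hq1 (by omega) hb hbc (fun j hj => ?_) w.antitone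
        (fun j hj => w.entry_eq_zero hj) (hrow _ (by omega)) (fun hT => ?_)
        (hD _ (by omega)) (hD1 _ (by omega)) (hD2 _ (by omega))
      · rw [hu.2 j (by omega), hbase, Function.update_of_ne (by omega)]
      -- The row is monotone because it is either the prescribed shape or, its weight being nonzero,
      -- interlaced with the next row.
      · rw [← e2] at hT ⊢
        by_cases h : 2 * n - d = 2 * n
        · rw [h, hlast]; exact z.anti
        · have h1 := Finset.prod_ne_zero_iff.1 hT (2 * n - d + 1)
            (Finset.mem_Icc.2 ⟨le_rfl, by omega⟩)
          rw [Nat.add_sub_cancel] at h1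
          refine (interlaced_of_rowWeight_ne_zero h1 (fun i hi => hrow _ (by omega) i ?_)
            (hrow _ (by omega))).antitone_left
          exact (levelSize_mono (by omega)).trans_lt hi
  have h0 := key (2 * n) le_rfl
  rw [Nat.sub_self] at h0
  -- Level `0` has no entries, so initially there are only clocks; at level `2n` there are only
  -- jumps.
  have h1 : ∀ u, levelRate q a (2 * n) w.entry 0 u = tailWeight q a (2 * n) 0 u *
      ∑ j ∈ Finset.Icc 1 (2 * n),
        levelParam a j * cascade q (2 * n - j) Dir.right j 1 u w.entry := by
    intro u
    rw [levelRate, show levelSize 0 = 0 from rfl, Finset.Icc_eq_empty (by omega : ¬ 1 ≤ 0),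
      Finset.sum_empty, mul_zero, zero_add, Finset.mul_sum, zero_add]
    exact Finset.sum_congr rfl fun j _ => by ring
  simp_rw [h1] at h0
  rw [h0, levelRate, Finset.Icc_eq_empty (by omega : ¬ 2 * n + 1 ≤ 2 * n), Finset.sum_empty, add_zero,
    levelSize_even, Nat.sub_self, tailWeight.eq_1 q a (2 * n) (2 * n),
    Finset.Icc_eq_empty (by omega : ¬ 2 * n + 1 ≤ 2 * n), Finset.prod_empty, mul_one,
    stepFactor_eq, Finset.mul_sum, Finset.mul_sum]
  refine Finset.sum_congr rfl fun i hi => ?_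
  have hn : 1 ≤ n := (Finset.mem_Icc.1 hi).1.trans (Finset.mem_Icc.1 hi).2
  have h2 : tailWeight q a (2 * n) 0 w.entry = tailWeight q a (2 * n - 1) 0 w.entry
      * stepWeight q a (2 * n) (w.entry (2 * n - 1)) (w.entry (2 * n)) := by
    obtain ⟨m, hm⟩ : ∃ m, 2 * n = m + 1 := ⟨2 * n - 1, by omega⟩
    rw [hm, tailWeight_zero_succ, Nat.add_sub_cancel]
  have h3 : ∀ c, w.entry = move base (2 * n) i c ↔ w.shape.part = bump z.part i c := by
    intro c
    rw [move_eq_update, hbase, Function.update_self, Function.update_idem]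
    constructor
    · intro h
      change w.entry (2 * n) = _
      rw [h, Function.update_self]
    · intro h
      change w.entry (2 * n) = _ at h
      rw [← h, Function.update_eq_self]
  have h4 : base (2 * n) = z.part := by rw [hbase, Function.update_self]
  have h5 : w.shape.part = w.entry (2 * n) := rfl
  simp only [cascade, h3]
  rw [h2, h4, rightRate, leftRate, if_neg (show ¬ 2 * n + 1 = 2 * i by omega), sub_zero, mul_add,
    mul_add]
  congr 1
  · split_ifs with h
    · rw [← h, h5]; ring
    · ring
  · split_ifs with h
    · rw [← h, h5]; ring
    · ring

/-! ### The jump rates are bounded -/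

section

variable {q : ℝ}

/-- The division lemmas used also cover a zero denominator, where the quotient is zero by default.
-/
theorem pushProb_mem (hq0 : 0 < q) (hq1 : q < 1) {i : ℕ} (hi : 1 ≤ i) {x y : ℕ → ℤ}
    (h : Interlaced x y) : 0 ≤ pushProb q i y x ∧ pushProb q i y x ≤ 1 := by
  rw [pushProb]
  split_ifs with h1
  · exact ⟨zpow_nonneg hq0.le _, zpow_le_one₀ hq0 hq1.le (by have := (h 1 le_rfl).2; omega)⟩
  · obtain ⟨k, rfl⟩ : ∃ k, i = k + 1 := ⟨i - 1, by omega⟩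
    rw [Nat.add_sub_cancel]
    have h2 := h k (by omega)
    have h3 := h (k + 1) (by omega)
    have h4 : 0 ≤ (1 - q ^ (x k - y (k + 1))) / (1 - q ^ (x k - x (k + 1))) :=
      div_nonneg (one_sub_zpow_nonneg hq0 hq1 (by omega)) (one_sub_zpow_nonneg hq0 hq1 (by omega))
    have h5 : (1 - q ^ (x k - y (k + 1))) / (1 - q ^ (x k - x (k + 1))) ≤ 1 := by
      refine div_le_one_of_le₀ ?_ (one_sub_zpow_nonneg hq0 hq1 (by omega))
      exact sub_le_sub_left (zpow_le_zpow_right_of_le_one₀ hq0 hq1.le (by omega)) _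
    exact ⟨mul_nonneg (zpow_nonneg hq0.le _) h4,
      mul_le_one₀ (zpow_le_one₀ hq0 hq1.le (by omega)) h4 h5⟩

theorem pullProb_mem (hq0 : 0 < q) (hq1 : q < 1) {i : ℕ} (hi : 1 ≤ i) {x y : ℕ → ℤ}
    (h : Interlaced x y) : 0 ≤ pullProb q i y x ∧ pullProb q i y x ≤ 1 := by
  rw [pullProb]
  have h2 := h i hi
  have h3 := h (i + 1) (by omega)
  have h4 : 0 ≤ (1 - q ^ (y (i + 1) - x (i + 1))) / (1 - q ^ (x i - x (i + 1))) :=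
    div_nonneg (one_sub_zpow_nonneg hq0 hq1 (by omega)) (one_sub_zpow_nonneg hq0 hq1 (by omega))
  have h5 : (1 - q ^ (y (i + 1) - x (i + 1))) / (1 - q ^ (x i - x (i + 1))) ≤ 1 := by
    refine div_le_one_of_le₀ ?_ (one_sub_zpow_nonneg hq0 hq1 (by omega))
    exact sub_le_sub_left (zpow_le_zpow_right_of_le_one₀ hq0 hq1.le (by omega)) _
  exact ⟨mul_nonneg (zpow_nonneg hq0.le _) h4,
    mul_le_one₀ (zpow_le_one₀ hq0 hq1.le (by omega)) h4 h5⟩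

/-- Cascades in interlacing arrays have subprobability laws. -/
theorem cascade_mem (hq0 : 0 < q) (hq1 : q < 1) (S : Finset (ℕ → ℕ → ℤ)) (d : ℕ) :
    ∀ (δ : Dir) (k i : ℕ) (u : ℕ → ℕ → ℤ), 1 ≤ i →
      (∀ j, k ≤ j → j < k + d → Interlaced (u j) (u (j + 1))) →
      (∀ w, 0 ≤ cascade q d δ k i u w) ∧ ∑ w ∈ S, cascade q d δ k i u w ≤ 1 := by
  classical
  induction d with
  | zero =>
    have h : ∀ v : ℕ → ℕ → ℤ, (∀ w, (0 : ℝ) ≤ if w = v then 1 else 0) ∧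
        ∑ w ∈ S, (if w = v then (1 : ℝ) else 0) ≤ 1 := by
      intro v
      refine ⟨fun w => by split_ifs <;> norm_num, ?_⟩
      rw [Finset.sum_ite_eq']
      split_ifs <;> norm_num
    intro δ k i u _ _
    cases δ
    · simp only [cascade]; convert h (move u k i 1)
    · simp only [cascade]; convert h (move u k i (-1))
  | succ d ih =>
    intro δ k i u hi hu
    -- A moved row is never consulted again, so interlacing is required only from the next level on.
    have hmove : ∀ c, ∀ j, k + 1 ≤ j → j < k + 1 + d →
        Interlaced (move u k i c j) (move u k i c (j + 1)) := by
      intro c j h1 h2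
      rw [move_of_ne u (by omega), move_of_ne u (by omega)]
      exact hu j (by omega) (by omega)
    have hsame : ∀ j, k + 1 ≤ j → j < k + 1 + d → Interlaced (u j) (u (j + 1)) :=
      fun j h1 h2 => hu j (by omega) (by omega)
    have mix : ∀ (r : ℝ) (f g : (ℕ → ℕ → ℤ) → ℝ), 0 ≤ r ∧ r ≤ 1 →
        ((∀ w, 0 ≤ f w) ∧ ∑ w ∈ S, f w ≤ 1) → ((∀ w, 0 ≤ g w) ∧ ∑ w ∈ S, g w ≤ 1) →
        (∀ w, 0 ≤ r * f w + (1 - r) * g w) ∧ ∑ w ∈ S, (r * f w + (1 - r) * g w) ≤ 1 := by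
      intro r f g hr hf hg
      have hr' : 0 ≤ 1 - r := sub_nonneg.2 hr.2
      refine ⟨fun w => add_nonneg (mul_nonneg hr.1 (hf.1 w)) (mul_nonneg hr' (hg.1 w)), ?_⟩
      rw [Finset.sum_add_distrib, ← Finset.mul_sum, ← Finset.mul_sum]
      have h1 := mul_le_mul_of_nonneg_left hf.2 hr.1
      have h2 := mul_le_mul_of_nonneg_left hg.2 hr'
      linarith
    have hk := hu k le_rfl (by omega)
    cases δ
    · simp only [cascade]
      by_cases h : k + 1 = 2 * i
      · simp only [if_pos h]
        exact mix _ _ _ (pushProb_mem hq0 hq1 hi hk) (ih _ _ _ _ hi (hmove 1)) (ih _ _ _ _ hi hsame)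
      · simp only [if_neg h]
        exact mix _ _ _ (pushProb_mem hq0 hq1 hi hk) (ih _ _ _ _ hi (hmove 1))
          (ih _ _ _ _ (by omega) (hmove 1))
    · simp only [cascade]
      exact mix _ _ _ (pullProb_mem hq0 hq1 hi hk) (ih _ _ _ _ (by omega) (hmove _))
        (ih _ _ _ _ hi (hmove _))

end

theorem Pattern.entry_injective {n : ℕ} : Function.Injective (Pattern.entry (n := n)) :=
  fun _ _ h => Pattern.ext h

/-- A bound by one on finite sets suffices for bounded row sums; that cascades end in patterns is
not needed here. -/
theorem ringProb_mem {q : ℝ} (hq0 : 0 < q) (hq1 : q < 1) {n k : ℕ} (hk : 1 ≤ k) (hkn : k ≤ 2 * n)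
    (p : Pattern n) (S : Finset (Pattern n)) :
    (∀ w, 0 ≤ ringProb q k p w) ∧ ∑ w ∈ S, ringProb q k p w ≤ 1 := by
  classical
  have h := cascade_mem hq0 hq1 (S.image Pattern.entry) (2 * n - k) Dir.right k 1 p.entry le_rfl
    fun j h1 h2 => p.interlaced j (by omega) (by omega)
  rw [Finset.sum_image fun x _ y _ h => Pattern.entry_injective h] at h
  exact ⟨fun w => h.1 w.entry, h.2⟩

theorem sum_Icc_two_mul (f : ℕ → ℝ) (n : ℕ) :
    ∑ j ∈ Finset.Icc 1 (2 * n), f j = ∑ l ∈ Finset.Icc 1 n, (f (2 * l - 1) + f (2 * l)) := by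
  induction n with
  | zero => simp
  | succ n ih =>
    rw [Finset.sum_Icc_succ_top (by omega), ← ih, show 2 * (n + 1) = 2 * n + 1 + 1 by ring,
      Finset.sum_Icc_succ_top (by omega), Finset.sum_Icc_succ_top (by omega), Nat.add_sub_cancel,
      add_assoc]

theorem prod_Icc_two_mul (f : ℕ → ℝ) (n : ℕ) :
    ∏ j ∈ Finset.Icc 1 (2 * n), f j = ∏ l ∈ Finset.Icc 1 n, (f (2 * l - 1) * f (2 * l)) := by
  induction n with
  | zero => simp
  | succ n ih =>
    rw [Finset.prod_Icc_succ_top (by omega), ← ih, show 2 * (n + 1) = 2 * n + 1 + 1 by ring,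
      Finset.prod_Icc_succ_top (by omega), Finset.prod_Icc_succ_top (by omega), Nat.add_sub_cancel,
      mul_assoc]

section

variable {a : ℕ → ℝ}

theorem levelParam_odd {l : ℕ} (hl : 1 ≤ l) : levelParam a (2 * l - 1) = a l := by
  rw [levelParam, if_pos (by omega), show (2 * l - 1 + 1) / 2 = l by omega]

theorem levelParam_even (l : ℕ) : levelParam a (2 * l) = (a l)⁻¹ := by
  rw [levelParam, if_neg (by omega), show 2 * l / 2 = l by omega]

theorem levelParam_pos {n : ℕ} (ha : ∀ i, 1 ≤ i → i ≤ n → 0 < a i) (j : ℕ) (h1 : 1 ≤ j)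
    (h2 : j ≤ 2 * n) : 0 < levelParam a j := by
  rw [levelParam]
  split_ifs
  · exact ha _ (by omega) (by omega)
  · exact inv_pos.2 (ha _ (by omega) (by omega))

theorem levelParam_mul {n : ℕ} (ha : ∀ i, 1 ≤ i → i ≤ n → 0 < a i) (p : ℕ) (h : 2 * p + 2 ≤ 2 * n) :
    levelParam a (2 * p + 1) * levelParam a (2 * p + 2) = 1 := by
  rw [show 2 * p + 1 = 2 * (p + 1) - 1 by omega, levelParam_odd (by omega),
    show 2 * p + 2 = 2 * (p + 1) by ring, levelParam_even]
  exact mul_inv_cancel₀ (ha _ (by omega) (by omega)).ne'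

theorem sum_levelParam (n : ℕ) :
    ∑ j ∈ Finset.Icc 1 (2 * n), levelParam a j = ∑ l ∈ Finset.Icc 1 n, (a l + (a l)⁻¹) := by
  rw [sum_Icc_two_mul]
  refine Finset.sum_congr rfl fun l hl => ?_
  rw [levelParam_odd (Finset.mem_Icc.1 hl).1, levelParam_even]

open Classical in
theorem patternRate_eq (q : ℝ) {n : ℕ} (p w : Pattern n) :
    patternRate q a p w = ∑ j ∈ Finset.Icc 1 (2 * n), levelParam a j * ringProb q j p w
      - (∑ l ∈ Finset.Icc 1 n, (a l + (a l)⁻¹)) * if p = w then 1 else 0 := by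
  rw [← sum_levelParam, Finset.sum_mul, ← Finset.sum_sub_distrib, sum_Icc_two_mul, patternRate]
  refine Finset.sum_congr rfl fun l hl => ?_
  rw [levelParam_odd (Finset.mem_Icc.1 hl).1, levelParam_even, mul_sub, mul_sub]

/-- The rings and the diagonal term each contribute at most the total clock rate, hence the factor
two. -/
theorem sum_abs_patternRate_le {q : ℝ} (hq0 : 0 < q) (hq1 : q < 1) {n : ℕ}
    (ha : ∀ i, 1 ≤ i → i ≤ n → 0 < a i) (p : Pattern n) (S : Finset (Pattern n)) :
    ∑ w ∈ S, |patternRate q a p w| ≤ 2 * ∑ l ∈ Finset.Icc 1 n, (a l + (a l)⁻¹) := by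
  classical
  have hc : 0 ≤ ∑ l ∈ Finset.Icc 1 n, (a l + (a l)⁻¹) := Finset.sum_nonneg fun l hl => by
    have := ha l (Finset.mem_Icc.1 hl).1 (Finset.mem_Icc.1 hl).2
    positivity
  have h1 : ∀ w, |patternRate q a p w| ≤ ∑ j ∈ Finset.Icc 1 (2 * n), levelParam a j * ringProb q j p w
      + (∑ l ∈ Finset.Icc 1 n, (a l + (a l)⁻¹)) * if w = p then 1 else 0 := by
    intro w
    rw [patternRate_eq, sub_eq_add_neg]
    refine (abs_add_le _ _).trans (le_of_eq ?_)
    rw [abs_neg, abs_of_nonneg, abs_of_nonneg]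
    · congr 2
      simp only [eq_comm]
    · exact mul_nonneg hc (by split_ifs <;> norm_num)
    · refine Finset.sum_nonneg fun j hj => ?_
      have := Finset.mem_Icc.1 hj
      exact mul_nonneg (levelParam_pos ha j this.1 this.2).le
        ((ringProb_mem hq0 hq1 this.1 this.2 p S).1 w)
  refine (Finset.sum_le_sum fun w _ => h1 w).trans ?_
  rw [Finset.sum_add_distrib, Finset.sum_comm, ← Finset.mul_sum, Finset.sum_ite_eq']
  refine (add_le_add ?_ ?_).trans (two_mul _).ge
  · rw [← sum_levelParam]
    refine Finset.sum_le_sum fun j hj => ?_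
    have := Finset.mem_Icc.1 hj
    rw [← Finset.mul_sum]
    exact mul_le_of_le_one_right (levelParam_pos ha j this.1 this.2).le
      (ringProb_mem hq0 hq1 this.1 this.2 p S).2
  · refine mul_le_of_le_one_right hc ?_
    split_ifs <;> norm_num

end

/-! ### Finiteness and positivity -/

instance (n : ℕ) : DiscreteMeasurableSpace (Pattern n) := ⟨fun _ => trivial⟩

instance (n : ℕ) : DiscreteMeasurableSpace (Shape n) := ⟨fun _ => trivial⟩

instance (n : ℕ) : Countable (Shape n) := by
  refine Function.Injective.countable (f := fun (z : Shape n) (i : Fin (n + 1)) => z.part i) ?_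
  intro z z' h
  ext i
  by_cases hi : i ≤ n
  · exact congrFun h ⟨i, by omega⟩
  · rw [z.support i (by omega), z'.support i (by omega)]

/-- At a fixed index the entries grow with the level, and the bottom row is largest at its first
entry. -/
theorem Pattern.entry_le {n : ℕ} (p : Pattern n) (k i : ℕ) : p.entry k i ≤ p.shape.part 1 := by
  by_cases h : 1 ≤ k ∧ k ≤ 2 * n ∧ 1 ≤ i ∧ i ≤ (k + 1) / 2
  · obtain ⟨hk, hkn, hi, -⟩ := h
    have h1 : ∀ j, k + j ≤ 2 * n → p.entry k i ≤ p.entry (k + j) i := by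
      intro j
      induction j with
      | zero => intro _; exact le_rfl
      | succ j ih =>
        intro hj
        exact (ih (by omega)).trans (p.interlaced (k + j) (by omega) (by omega) i hi).2
    have h2 := h1 (2 * n - k) (by omega)
    rw [Nat.add_sub_cancel' hkn] at h2
    have h3 : ∀ j, p.entry (2 * n) (j + 1) ≤ p.entry (2 * n) 1 := by
      intro j
      induction j with
      | zero => exact le_rfl
      | succ j ih => exact (p.antitone (j + 1) (by omega)).trans ih
    have h4 := h3 (i - 1)
    rw [Nat.sub_add_cancel hi] at h4
    exact h2.trans h4
  · rw [p.support k i h]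
    exact p.shape.nonneg 1

theorem finite_fiber {n : ℕ} (z : Shape n) : {p : Pattern n | p.shape = z}.Finite := by
  refine Set.Finite.of_injOn
    (f := fun (p : Pattern n) (k : Fin (2 * n + 1)) (i : Fin (n + 1)) => p.entry k i)
    (t := {f | ∀ k, f k ∈ {g : Fin (n + 1) → ℤ | ∀ i, g i ∈ Set.Icc 0 (z.part 1)}}) ?_ ?_
    (Set.Finite.pi' fun _ => Set.Finite.pi' fun _ => Set.finite_Icc _ _)
  · rintro p rfl k i
    exact ⟨p.nonneg _ _, p.entry_le _ _⟩
  · intro p _ p' _ h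
    ext k i
    by_cases hi : 1 ≤ k ∧ k ≤ 2 * n ∧ 1 ≤ i ∧ i ≤ (k + 1) / 2
    · exact congrFun (congrFun h ⟨k, by omega⟩) ⟨i, by omega⟩
    · rw [p.support k i hi, p'.support k i hi]

/-- The patterns of shape `z`. -/
noncomputable def fiber {n : ℕ} (z : Shape n) : Finset (Pattern n) := (finite_fiber z).toFinset

theorem mem_fiber {n : ℕ} {z : Shape n} {p : Pattern n} : p ∈ fiber z ↔ p.shape = z := by
  simp [fiber]

theorem fiber_nonempty {n : ℕ} (z : Shape n) : (fiber z).Nonempty := by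
  -- The witness takes for every row the truncation of `z` to the length of its level.
  refine ⟨⟨fun k i => if 1 ≤ k ∧ k ≤ 2 * n ∧ i ≤ (k + 1) / 2 then z.part i else 0, ?_, ?_, ?_⟩,
    mem_fiber.2 ?_⟩
  · intro k i
    split_ifs
    exacts [z.nonneg i, le_rfl]
  · intro k i h
    split_ifs with h1
    · exact z.support i (by omega)
    · rfl
  · intro k hk hkn i hi
    have h1 := z.anti i hi
    have h2 := z.nonneg i
    have h3 := z.nonneg (i + 1)
    simp only
    constructor
    · split_ifs <;> omega
    · split_ifs <;> omega
  · ext i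
    simp only [Pattern.shape]
    split_ifs with h
    · rfl
    · exact (z.support i (by omega)).symm

theorem rowWeight_pos {q b : ℝ} (hq0 : 0 < q) (hq1 : q < 1) (hb : 0 < b) {m : ℕ} {x y : ℕ → ℤ}
    (h : Interlaced x y) : 0 < rowWeight q b m x y := by
  refine mul_pos (zpow_pos hb _) (Finset.prod_pos fun i hi => ?_)
  have := h i (Finset.mem_Icc.1 hi).1
  exact qBinom_pos hq0 hq1 (by omega) (by omega)

theorem Pattern.interlaced_pred {n : ℕ} (p : Pattern n) {k : ℕ} (hk : 1 ≤ k) (hkn : k ≤ 2 * n) :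
    Interlaced (p.entry (k - 1)) (p.entry k) := by
  by_cases h : k = 1
  · subst h
    intro i hi
    rw [p.support 1 (i + 1) (by omega), p.support 0 i (by omega)]
    exact ⟨le_rfl, p.nonneg 1 i⟩
  · have := p.interlaced (k - 1) (by omega) (by omega)
    rwa [Nat.sub_add_cancel hk] at this

section

variable {q : ℝ} {a : ℕ → ℝ} {n : ℕ}

/-- The exponent splits as `2A - B - C = (A - B) + (A - C)`, which gives parameter `a_k` on the odd
level and its inverse on the even one. The extra last q-binomial of the odd level has equal
arguments and is one. -/
theorem weight_eq (hq0 : 0 < q) (hq1 : q < 1) (ha : ∀ i, 1 ≤ i → i ≤ n → 0 < a i) (p : Pattern n) :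
    weight q a p = tailWeight q a (2 * n) 0 p.entry := by
  rw [weight, tailWeight, zero_add, prod_Icc_two_mul]
  refine Finset.prod_congr rfl fun k hk => ?_
  obtain ⟨hk1, hkn⟩ := Finset.mem_Icc.1 hk
  have hak := (ha k hk1 hkn).ne'
  obtain ⟨l, rfl⟩ : ∃ l, k = l + 1 := ⟨k - 1, by omega⟩
  have e1 : 2 * (l + 1) - 1 = 2 * l + 1 := by omega
  have e2 : 2 * (l + 1) = 2 * l + 2 := by ring
  have s1 : levelSize (2 * l + 1) = l + 1 := levelSize_odd l
  have s2 : levelSize (2 * l + 2) = l + 1 := by unfold levelSize; omega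
  have p1 : levelParam a (2 * l + 1) = a (l + 1) := by
    rw [← e1, levelParam_odd (by omega)]
  have p2 : levelParam a (2 * l + 2) = (a (l + 1))⁻¹ := by rw [← e2, levelParam_even]
  rw [levelWeight, e1, e2, stepWeight, stepWeight, s1, s2, p1, p2, rowWeight, rowWeight,
    show 2 * l + 2 - 2 = 2 * l by omega, show 2 * l + 1 - 1 = 2 * l by omega,
    Nat.add_sub_cancel]
  have z1 : p.entry (2 * l) (l + 1) = 0 := p.support _ _ (by omega)
  have z2 : p.entry (2 * l + 1) (l + 1 + 1) = 0 := p.support _ _ (by omega)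
  have z3 : p.entry (2 * l + 2) (l + 1 + 1) = 0 := p.support _ _ (by omega)
  rw [Finset.prod_Icc_succ_top (by omega), Finset.prod_Icc_succ_top (by omega), z1, z2, z3,
    Finset.sum_Icc_succ_top (by omega) (p.entry (2 * l)), z1, sub_zero, sub_zero, add_zero,
    qBinom_self hq0 hq1 (p.nonneg _ _), Finset.prod_mul_distrib, inv_zpow', neg_sub, mul_one]
  rw [show ∀ A B C : ℤ, 2 * A - B - C = (A - B) + (A - C) by intros; ring, zpow_add₀ hak]
  ring

theorem weight_pos (hq0 : 0 < q) (hq1 : q < 1) (ha : ∀ i, 1 ≤ i → i ≤ n → 0 < a i) (p : Pattern n) :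
    0 < weight q a p := by
  rw [weight_eq hq0 hq1 ha]
  refine Finset.prod_pos fun j hj => ?_
  obtain ⟨h1, h2⟩ := Finset.mem_Icc.1 hj
  exact rowWeight_pos hq0 hq1 (levelParam_pos ha j (by omega) h2) (p.interlaced_pred (by omega) h2)

theorem shapeFun_eq (z : Shape n) : shapeFun q a z = ∑ p ∈ fiber z, weight q a p := by
  rw [shapeFun, ← Finset.tsum_subtype (fiber z) (weight q a)]
  let e : {p // p ∈ fiber z} ≃ {p : Pattern n // p.shape = z} :=
    Equiv.subtypeEquivRight fun _ => mem_fiber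
  exact (e.tsum_eq fun p : {p : Pattern n // p.shape = z} => weight q a p.1).symm

theorem shapeFun_pos (hq0 : 0 < q) (hq1 : q < 1) (ha : ∀ i, 1 ≤ i → i ≤ n → 0 < a i) (z : Shape n) :
    0 < shapeFun q a z := by
  rw [shapeFun_eq]
  exact Finset.sum_pos (fun p _ => weight_pos hq0 hq1 ha p) (fiber_nonempty z)

end

/-- The rows with at most `m` entries, all of them of absolute value at most `B`. -/
theorem finite_rows (m : ℕ) (B : ℕ) :
    {x : ℕ → ℤ | (∀ i, |x i| ≤ B) ∧ ∀ i, ¬ (1 ≤ i ∧ i ≤ m) → x i = 0}.Finite := by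
  refine Set.Finite.of_injOn (f := fun (x : ℕ → ℤ) (i : Fin (m + 1)) => x i)
    (t := {f | ∀ i, f i ∈ Set.Icc (-(B : ℤ)) B}) ?_ ?_ (Set.Finite.pi' fun _ => Set.finite_Icc _ _)
  · intro x hx i
    exact abs_le.1 (hx.1 i)
  · intro x hx y hy h
    funext i
    by_cases hi : 1 ≤ i ∧ i ≤ m
    · exact congrFun h ⟨i, by omega⟩
    · rw [hx.2 i hi, hy.2 i hi]

theorem nonneg_of_antitone {x : ℕ → ℤ} {m : ℕ} (hx : ∀ i, 1 ≤ i → x (i + 1) ≤ x i)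
    (h0 : ∀ i, m < i → x i = 0) (i : ℕ) (hi : 1 ≤ i) : 0 ≤ x i := by
  have h : ∀ j, x (i + j) ≤ x i := by
    intro j
    induction j with
    | zero => exact le_rfl
    | succ j ih => exact (hx (i + j) (by omega)).trans ih
  rw [← h0 (i + (m + 1)) (by omega)]
  exact h (m + 1)

/-! ### Balance on the fibres and the intertwining -/

section

variable {q : ℝ} {a : ℕ → ℝ} {n : ℕ}

/-- Balance of the weights of a fibre under the dynamics. -/
theorem sum_fiber_weight_mul_ringProb (hq0 : 0 < q) (hq1 : q < 1)
    (ha : ∀ i, 1 ≤ i → i ≤ n → 0 < a i) (z : Shape n) (w : Pattern n) :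
    ∑ p ∈ fiber z, weight q a p * ∑ j ∈ Finset.Icc 1 (2 * n), levelParam a j * ringProb q j p w
      = weight q a w * stepFactor q z w.shape := by
  classical
  -- Bounds the entries of `w`, of all patterns of shape `z`, and of rows of `w` with one entry
  -- changed by a unit.
  obtain ⟨B, hB⟩ : ∃ B : ℕ, (B : ℤ) = z.part 1 + w.shape.part 1 + 1 :=
    ⟨(z.part 1 + w.shape.part 1 + 1).toNat, by
      have := z.nonneg 1; have := w.shape.nonneg 1; omega⟩
  have hz1 := z.nonneg 1
  have hw1 := w.shape.nonneg 1
  let D : ℕ → Finset (ℕ → ℤ) := fun k => (finite_rows (levelSize k) B).toFinset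
  have memD : ∀ k x, x ∈ D k ↔ (∀ i, |x i| ≤ B) ∧ ∀ i, ¬ (1 ≤ i ∧ i ≤ levelSize k) → x i = 0 := by
    intro k x; simp [D]
  have hsupp : ∀ (p : Pattern n) k i, ¬ (1 ≤ i ∧ i ≤ levelSize k) → p.entry k i = 0 :=
    fun p k i h => p.support k i (by unfold levelSize at h; omega)
  have hD : ∀ k, w.entry k ∈ D k := by
    refine fun k => (memD _ _).2 ⟨fun i => ?_, hsupp w k⟩
    rw [abs_of_nonneg (w.nonneg k i)]
    have := w.entry_le k i
    omega
  have hDb : ∀ k, ∀ i ∈ Finset.Icc 1 (levelSize k), ∀ c : ℤ, |c| ≤ 1 → bump (w.entry k) i c ∈ D k := by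
    refine fun k i hi c hc => (memD _ _).2 ⟨fun j => ?_, fun j hj => ?_⟩
    · have h1 := w.entry_le k j
      have h2 := w.nonneg k j
      rw [abs_le] at hc ⊢
      by_cases h : j = i
      · subst h; rw [bump_self]; omega
      · rw [bump_of_ne _ h]; omega
    · rw [bump_of_ne, hsupp w k j hj]
      rintro rfl
      exact hj (Finset.mem_Icc.1 hi)
  have h := sum_sources hq0 hq1 (a := a) (fun j h1 h2 => (levelParam_pos ha j h1 h2).ne')
    (levelParam_mul ha) z w (D := D) (fun k _ => hD k) (fun k _ i hi => hDb k i hi 1 (by norm_num))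
    (fun k _ i hi => hDb k i hi (-1) (by norm_num))
    (fun k x hx j hj => ((memD k x).1 hx).2 j (by omega))
  -- The sum over the fibre is enlarged to all arrays in the box with bottom row `z`; the added
  -- arrays are shown to have weight zero.
  rw [weight_eq hq0 hq1 ha w, ← h,
    ← Finset.sum_subset (s₁ := (fiber z).image Pattern.entry),
    Finset.sum_image fun x _ y _ h => Pattern.entry_injective h]
  · refine Finset.sum_congr rfl fun p _ => ?_
    rw [weight_eq hq0 hq1 ha]
    rfl
  · intro u hu
    obtain ⟨p, hp, rfl⟩ := Finset.mem_image.1 hu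
    rw [mem_fiber] at hp
    subst hp
    refine (mem_sources le_rfl).2 ⟨fun j _ _ => (memD _ _).2 ⟨fun i => ?_, hsupp p j⟩, fun j hj => ?_⟩
    · rw [abs_of_nonneg (p.nonneg j i)]
      have := p.entry_le j i
      omega
    · by_cases h : j = 2 * n
      · subst h; rw [Function.update_self]; rfl
      · rw [Function.update_of_ne h]
        funext i
        rw [p.support j i (by omega), w.support j i (by omega)]
  · intro u hu hu'
    rw [mem_sources le_rfl] at hu
    refine mul_eq_zero_of_left ?_ _
    by_contra hne
    refine hu' (Finset.mem_image.2 ?_)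
    have hlast : u (2 * n) = z.part := by rw [hu.2 _ (by omega), Function.update_self]
    have hout : ∀ j, 2 * n < j → ∀ i, u j i = 0 := by
      intro j hj i
      rw [hu.2 j (by omega), Function.update_of_ne (by omega), w.support j i (by omega)]
    have hrow : ∀ j i, ¬ (1 ≤ i ∧ i ≤ levelSize j) → u j i = 0 := by
      intro j i hi
      rcases lt_trichotomy j (2 * n) with h | rfl | h
      · exact ((memD _ _).1 (hu.1 j (by omega) h)).2 i hi
      · rw [hlast]; exact z.support i (by rwa [levelSize_even] at hi)
      · exact hout j h i
    have hint : ∀ j, 1 ≤ j → j ≤ 2 * n → Interlaced (u (j - 1)) (u j) := by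
      intro j h1 h2
      refine interlaced_of_rowWeight_ne_zero
        (Finset.prod_ne_zero_iff.1 hne j (Finset.mem_Icc.2 ⟨by omega, h2⟩))
        (fun i hi => hrow _ i ?_) (fun i hi => hrow _ i (by omega))
      have := levelSize_mono (show j - 1 ≤ j by omega)
      omega
    refine ⟨⟨u, fun k i => ?_, fun k i h => ?_, fun k h1 h2 => ?_⟩, mem_fiber.2 ?_, rfl⟩
    -- Rows in the box may have negative entries; a nonincreasing row that is eventually zero has
    -- none.
    · by_cases h : 1 ≤ i ∧ i ≤ levelSize k
      · by_cases hk : k ≤ 2 * n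
        · have hk1 : 1 ≤ k := by unfold levelSize at h; omega
          exact nonneg_of_antitone (hint k hk1 hk).antitone_right
            (m := levelSize k) (fun j hj => hrow k j (by omega)) i h.1
        · rw [hout k (by omega)]
      · rw [hrow k i h]
    · by_cases hk : k ≤ 2 * n
      · exact hrow k i (by unfold levelSize; omega)
      · exact hout k (by omega) i
    · exact hint (k + 1) (by omega) (by omega)
    · exact Shape.ext hlast

open Classical in
/-- The mass of the pattern `p` under the law `gibbs q a z`. -/
noncomputable def gibbsMass (q : ℝ) (a : ℕ → ℝ) {n : ℕ} (z : Shape n) (p : Pattern n) : ℝ :=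
  if p.shape = z then weight q a p / shapeFun q a z else 0

theorem isLink_gibbsMass (hq0 : 0 < q) (hq1 : q < 1) (ha : ∀ i, 1 ≤ i → i ≤ n → 0 < a i) :
    IsLink (Pattern.shape (n := n)) fiber (gibbsMass q a) where
  mem_fiber z p := mem_fiber
  nonneg z p := by
    rw [gibbsMass]
    split_ifs
    · exact div_nonneg (weight_pos hq0 hq1 ha p).le (shapeFun_pos hq0 hq1 ha z).le
    · exact le_rfl
  zero_of_ne z p h := if_neg h
  sum_eq_one z := by
    have h : ∀ p ∈ fiber z, gibbsMass q a z p = weight q a p / shapeFun q a z :=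
      fun p hp => if_pos (mem_fiber.1 hp)
    rw [Finset.sum_congr rfl h, ← Finset.sum_div, ← shapeFun_eq,
      div_self (shapeFun_pos hq0 hq1 ha z).ne']

theorem stepFactor_self (q : ℝ) (z : Shape n) : stepFactor q z z = 0 := by
  refine Finset.sum_eq_zero fun i _ => ?_
  have h1 : z.part ≠ z.part + Pi.single i 1 := fun h => by
    have := congrFun h i
    simp at this
  have h2 : z.part ≠ z.part - Pi.single i 1 := fun h => by
    have := congrFun h i
    simp at this
    omega
  rw [if_neg h1, if_neg h2, add_zero]

theorem finite_shapeRate_ne_zero (q : ℝ) (a : ℕ → ℝ) (z : Shape n) :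
    {z' | shapeRate q a z z' ≠ 0}.Finite := by
  classical
  refine Set.Finite.of_injOn (f := Shape.part)
    (t := insert z.part (⋃ i ∈ Finset.Icc 1 n,
      {z.part + Pi.single i 1, z.part - Pi.single i 1})) ?_ (fun x _ y _ h => Shape.ext h) ?_
  · intro z' hz'
    by_cases h : z' = z
    · exact Or.inl (by rw [h])
    · refine Or.inr ?_
      by_contra hcon
      simp only [Set.mem_iUnion, not_exists, Set.mem_insert_iff, Set.mem_singleton_iff,
        not_or] at hcon
      refine hz' ?_
      rw [shapeRate, if_neg h, stepFactor, Finset.sum_eq_zero, mul_zero]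
      intro i hi
      rw [if_neg (hcon i hi).1, if_neg (hcon i hi).2, add_zero]
  · exact (Set.Finite.biUnion (Finset.finite_toSet _) fun i _ => by simp).insert _

/-- Balance gives the off-diagonal part after division by the normalising constants. On the diagonal
`stepFactor` is zero, so only the total clock rate survives. -/
theorem isIntertwined (hq0 : 0 < q) (hq1 : q < 1) (ha : ∀ i, 1 ≤ i → i ≤ n → 0 < a i) :
    IsIntertwined (Pattern.shape (n := n)) fiber (gibbsMass q a) (patternRate q a)
      (shapeRate q a) where
  toIsLink := isLink_gibbsMass hq0 hq1 ha
  intertwine z w := by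
    classical
    have hz := (shapeFun_pos hq0 hq1 ha z).ne'
    have hw := (shapeFun_pos hq0 hq1 ha w.shape).ne'
    have h : ∀ p ∈ fiber z, gibbsMass q a z p * patternRate q a p w
        = (shapeFun q a z)⁻¹ * (weight q a p *
            ∑ j ∈ Finset.Icc 1 (2 * n), levelParam a j * ringProb q j p w)
          - (shapeFun q a z)⁻¹ * (∑ l ∈ Finset.Icc 1 n, (a l + (a l)⁻¹))
            * (if p = w then weight q a p else 0) := by
      intro p hp
      rw [gibbsMass, if_pos (mem_fiber.1 hp), patternRate_eq]
      split_ifs <;> ring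
    rw [Finset.sum_congr rfl h, Finset.sum_sub_distrib, ← Finset.mul_sum, ← Finset.mul_sum,
      sum_fiber_weight_mul_ringProb hq0 hq1 ha, Finset.sum_ite_eq', gibbsMass, if_pos rfl, shapeRate]
    by_cases hs : w.shape = z
    · rw [if_pos (mem_fiber.2 hs), if_pos hs, hs, stepFactor_self]
      ring
    · rw [if_neg (fun h => hs (mem_fiber.1 h)), if_neg hs]
      field_simp
      ring
  finite_rows := finite_shapeRate_ne_zero q a
  bounded := ⟨_, sum_abs_patternRate_le hq0 hq1 ha⟩

theorem gibbs_real (hq0 : 0 < q) (hq1 : q < 1) (ha : ∀ i, 1 ≤ i → i ≤ n → 0 < a i) (z : Shape n)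
    (A : Set (Pattern n)) :
    (gibbs q a z).real A = ∑ p ∈ fiber z, gibbsMass q a z p * A.indicator (fun _ => 1) p := by
  classical
  have h : gibbs q a z A
      = ∑ p ∈ fiber z, ENNReal.ofReal (gibbsMass q a z p * A.indicator (fun _ => 1) p) := by
    rw [gibbs, Measure.sum_apply _ (.of_discrete), tsum_eq_sum (s := fiber z)]
    · refine Finset.sum_congr rfl fun p _ => ?_
      rw [Measure.smul_apply, Measure.dirac_apply' _ .of_discrete, smul_eq_mul,
        ENNReal.ofReal_mul ((isLink_gibbsMass hq0 hq1 ha).nonneg z p), gibbsMass]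
      congr 1
      by_cases hp : p ∈ A <;> simp [hp]
    · intro p hp
      rw [if_neg (fun h => hp (mem_fiber.2 h)), ENNReal.ofReal_zero, zero_smul]
      rfl
  have hnn : ∀ p, 0 ≤ gibbsMass q a z p * A.indicator (fun _ => 1) p := fun p =>
    mul_nonneg ((isLink_gibbsMass hq0 hq1 ha).nonneg z p)
      (Set.indicator_nonneg (fun _ _ => zero_le_one) p)
  rw [measureReal_def, h, ← ENNReal.ofReal_sum_of_nonneg fun p _ => hnn p,
    ENNReal.toReal_ofReal (Finset.sum_nonneg fun p _ => hnn p)]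

end

end Berele

/-! ### The theorem -/

open Berele
theorem mainTheorem2 (n : ℕ) (hn : 1 ≤ n) (q : ℝ) (hq0 : 0 < q) (hq1 : q < 1)
    (a : ℕ → ℝ) (ha : ∀ i, 1 ≤ i → i ≤ n → 0 < a i)
    {Ω : Type*} [MeasurableSpace Ω] (μ : Measure Ω) [IsProbabilityMeasure μ]
    (Z : ℝ≥0 → Ω → Pattern n) (z : Shape n)
    (hZ : IsMarkovChain μ Z (patternRate q a))
    (hinit : μ.map (Z 0) = gibbs q a z) :
    IsMarkovChain μ (fun t ω => (Z t ω).shape) (shapeRate q a) ∧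
    (∀ᵐ ω ∂μ, (Z 0 ω).shape = z) ∧
    ∀ (t : ℝ≥0) (A : Set (Pattern n)),
      μ[(Z t ⁻¹' A).indicator (fun _ => (1 : ℝ)) | history (fun s ω => (Z s ω).shape) t]
        =ᵐ[μ] fun ω => (gibbs q a (Z t ω).shape).real A := by
  have h0 : ∀ p, μ.real (Z 0 ⁻¹' {p}) = gibbsMass q a z p := by
    intro p
    rw [← map_measureReal_apply (hZ.measurable 0) .of_discrete, hinit, gibbs_real hq0 hq1 ha]
    by_cases hp : p ∈ fiber z
    · rw [Finset.sum_eq_single_of_mem p hp fun x _ hx => by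
        rw [Set.indicator_of_notMem (by simpa using hx), mul_zero]]
      simp
    · rw [(isLink_gibbsMass hq0 hq1 ha).zero_of_ne z p fun h => hp (mem_fiber.2 h)]
      refine Finset.sum_eq_zero fun x hx => ?_
      rw [Set.indicator_of_notMem, mul_zero]
      rintro rfl
      exact hp hx
  have h := hZ.image (isIntertwined hq0 hq1 ha) z h0
  -- Turns the Gibbs measure into the finite fibre sum in which the general result is phrased.
  simp only [gibbs_real hq0 hq1 ha]
  exact h
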